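/- Let $\mathfrak g$ be a finite-dimensional complex simple Lie algebra of type $X_l$ with Cartan matrix $A_{ij}=2(\alpha_i|\alpha_j)/(\alpha_i|\alpha_i)$, where the form is normalized so that long roots have square length $2$; put $d_i=(\alpha_i|\alpha_i)/2$. Let $h\in\mathbb C$ be such that $q=e^{h}$ is not a root of unity, write $q^x=e^{xh}$ for $x\in\mathbb Q$, $q_i=q^{d_i}$, $[x]=(q^x-q^{-x})/(q-q^{-1})$, and let $\left[{N\atop s}\right]_i$ be the $q_i$-binomial coefficients. Let $U_q(\widehat{\mathfrak g})$ be the quantum affine algebra of the untwisted type $X_l^{(1)}$ in Drinfeld's realization: the associative $\mathbb C$-algebra generated by $\gamma^{\pm1/2}$ (central), $k_i^{\pm1}$, $d$, $a_i(n)$ ($n\neq0$), $x_i^{\pm}(n)$ ($n\in\mathbb Z$), $1\le i\le l$, with the relations $$[k_i,k_j]=[k_i,d]=[k_i,a_j(n)]=0,\quad k_ix_j^\pm(n)k_i^{-1}=q^{\pm(\alpha_i|\alpha_j)}x_j^\pm(n),\quad [d,a_i(n)]=na_i(n),\quad [d,x_i^\pm(n)]=nx_i^\pm(n),$$ $$[a_i(m),a_j(n)]=\delta_{m,-n}\frac{[(\alpha_i|\alpha_j)m]}{m}\,\frac{\gamma^m-\gamma^{-m}}{q-q^{-1}},\qquad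 [a_i(m),x_j^\pm(n)]=\pm\frac{[(\alpha_i|\alpha_j)m]}{m}\gamma^{\mp|m|/2}x_j^\pm(m+n),$$ $$(z-q^{\pm(\alpha_i|\alpha_j)}w)\,x_i^\pm(z)x_j^\pm(w)=(q^{\pm(\alpha_i|\alpha_j)}z-w)\,x_j^\pm(w)x_i^\pm(z),$$ $$[x_i^+(m),x_j^-(n)]=\frac{\delta_{ij}}{q_i-q_i^{-1}}\bigl(\gamma^{(m-n)/2}\psi_i(m+n)-\gamma^{(n-m)/2}\phi_i(m+n)\bigr),$$ $$\mathrm{Sym}_{m_1,\dots,m_N}\sum_{s=0}^{N}(-1)^s\left[{N\atop s}\right]_i x_i^\pm(m_1)\cdots x_i^\pm(m_s)\,x_j^\pm(n)\,x_i^\pm(m_{s+1})\cdots x_i^\pm(m_N)=0\qquad(i\ne j,\ N=1-A_{ij}),$$ where $x_i^\pm(z)=\sum_n x_i^\pm(n)z^{-n}$, $\sum_{n\ge0}\psi_i(n)z^{-n}=k_i\exp\bigl((q-q^{-1})\sum_{n>0}a_i(n)z^{-n}\bigr)$, $\sum_{n\ge0}\phi_i(-n)z^{n}=k_i^{-1}\exp\bigl((q^{-1}-q)\sum_{n>0}a_i(-n)z^{n}\bigr)$,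 and $\psi_i(n)=\phi_i(-n)=0$ for $n<0$. Let $k\in\mathbb Q$, $k\neq0$, and let $V$ be a $U_q(\widehat{\mathfrak g})$-module such that: (1) $V$ has level $k$, that is, $\gamma^{1/2}$ acts as $q^{k/2}$ (so $\gamma$ acts as $q^k$); (2) $V=\bigoplus_{a\in\mathbb C}V_a$, where $V_a=\{v: d\,v=av\}$, and the weight spaces (simultaneous eigenspaces of $d,k_1,\dots,k_l$) are finite-dimensional; (3) for each $a\in\mathbb C$ there is $n_0\ge 0$ such that $V_{a+n}=0$ for all integers $n>n_0$. On $V$ define $$E_-^{\pm}(\alpha_i,z)=\exp\Bigl(\mp\sum_{n\ge1}\frac{q^{\mp kn/2}}{[kn]}a_i(-n)z^n\Bigr),\qquad E_+^{\pm}(\alpha_i,z)=\exp\Bigl(\pm\sum_{n\ge1}\frac{q^{\mp kn/2}}{[kn]}a_i(n)z^{-n}\Bigr),$$ let $E_+^\pm(-\alpha_i,z)$ be given by the latter formula with $-a_i(n)$ in place of $a_i(n)$, and define the quantum $Z$-operators $Z_i^\pm(n)$ ($n\in\mathbb Z$) by $$Z^\pm(\alpha_i,z)=E_-^\pm(\alpha_i,z)\,x_i^\pm(z)\,E_+^\pm(\alpha_i,z)=\sum_{n\in\mathbb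 Z}Z_i^\pm(n)z^{-n}.$$ The vacuum space is $\Omega_V=\{v\in V: E_+^\pm(\alpha_i,z)v=E_+^\pm(-\alpha_i,z)v=v\ \text{ for all } i\}$. Then the operators $Z_i^\pm(n)$ are well defined (applied to any vector, the sum of products of coefficients that defines $Z_i^\pm(n)$ has only finitely many nonzero terms), they map $\Omega_V$ into itself, and $V$ is an irreducible $U_q(\widehat{\mathfrak g})$-module if and only if $\Omega_V$ is irreducible under the quantum $Z$-operators, that is, $\Omega_V\neq0$ and the only subspaces of $\Omega_V$ stable under all $Z_i^\pm(n)$ are $0$ and $\Omega_V$. -/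

import Mathlib

namespace QuantumZ

noncomputable section

/-! ### Finite type data -/

/-- The finite types `X_l` for which `X_l^{(1)}` is an untwisted affine type. -/
inductive DynkinType : Type
  | A (l : ℕ) (hl : 1 ≤ l)
  | B (l : ℕ) (hl : 3 ≤ l)
  | C (l : ℕ) (hl : 2 ≤ l)
  | D (l : ℕ) (hl : 4 ≤ l)
  | E6
  | E7
  | E8
  | F4
  | G2

/-- The rank `l` of the simple Lie algebra. -/
def DynkinType.rank : DynkinType → ℕ
  | .A l _ => l
  | .B l _ => l
  | .C l _ => l
  | .D l _ => l
  | .E6 => 6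
  | .E7 => 7
  | .E8 => 8
  | .F4 => 4
  | .G2 => 2

/-- The Cartan matrix `A_{ij} = 2 (α_i|α_j) / (α_i|α_i)`.  Mathlib's Cartan matrices follow the
convention `2 (α_i|α_j) / (α_j|α_j)`, hence the transposes. -/
def DynkinType.cartan : (T : DynkinType) → Matrix (Fin T.rank) (Fin T.rank) ℤ
  | .A l _ => (CartanMatrix.A l).transpose
  | .B l _ => (CartanMatrix.B l).transpose
  | .C l _ => (CartanMatrix.C l).transpose
  | .D l _ => (CartanMatrix.D l).transpose
  | .E6 => CartanMatrix.E₆.transpose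
  | .E7 => CartanMatrix.E₇.transpose
  | .E8 => CartanMatrix.E₈.transpose
  | .F4 => CartanMatrix.F₄.transpose
  | .G2 => CartanMatrix.G₂.transpose

/-- The numbers `d_i = (α_i|α_i) / 2`, for the invariant form in which long roots have square
length `2`. -/
def DynkinType.halfSq : (T : DynkinType) → Fin T.rank → ℚ
  | .A _ _ => fun _ => 1
  | .B l _ => fun (i : Fin l) => if i.val + 1 = l then 1 / 2 else 1
  | .C l _ => fun (i : Fin l) => if i.val + 1 = l then 1 else 1 / 2
  | .D _ _ => fun _ => 1
  | .E6 => fun _ => 1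
  | .E7 => fun _ => 1
  | .E8 => fun _ => 1
  | .F4 => ![1, 1, 1 / 2, 1 / 2]
  | .G2 => ![1, 1 / 3]

/-- The invariant form on simple roots, `(α_i|α_j) = d_i A_{ij}`. -/
def DynkinType.form (T : DynkinType) (i j : Fin T.rank) : ℚ :=
  T.halfSq i * (T.cartan i j : ℚ)

/-! ### `q`-numbers.  Throughout `q = exp h`, so that all rational powers of `q` are determined. -/

/-- `q ^ x = exp (x h)`. -/
def qpow (h : ℂ) (x : ℚ) : ℂ := Complex.exp ((x : ℂ) * h)

/-- `[x] = (q ^ x - q ^ (-x)) / (q - q⁻¹)`. -/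
def qnum (h : ℂ) (x : ℚ) : ℂ := (qpow h x - qpow h (-x)) / (qpow h 1 - qpow h (-1))

/-- `[n]_i = (q_i ^ n - q_i ^ (-n)) / (q_i - q_i⁻¹)` with `q_i = q ^ c`. -/
def qint (h : ℂ) (c : ℚ) (n : ℕ) : ℂ :=
  (qpow h (c * n) - qpow h (-(c * n))) / (qpow h c - qpow h (-c))

/-- `[n]_i ! = [1]_i ⋯ [n]_i`. -/
def qfactorial (h : ℂ) (c : ℚ) (n : ℕ) : ℂ := ∏ r ∈ Finset.range n, qint h c (r + 1)

/-- The `q_i`-binomial coefficient, for `s ≤ N`. -/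
def qbinom (h : ℂ) (c : ℚ) (N s : ℕ) : ℂ :=
  qfactorial h c N / (qfactorial h c s * qfactorial h c (N - s))

/-! ### Exponentials of power series with noncommuting coefficients -/

/-- The formal exponential `∑_j f ^ j / j!` of a power series `f` without constant term, over a
possibly noncommutative algebra (so that `f ^ j` contributes to the `N`-th coefficient only when
`j ≤ N`). -/
def expSeries {R : Type*} [Ring R] [Algebra ℂ R] (f : PowerSeries R) : PowerSeries R :=
  PowerSeries.mk fun N =>
    ∑ j ∈ Finset.range (N + 1), ((j.factorial : ℂ)⁻¹) • PowerSeries.coeff N (f ^ j)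

/-! ### The quantum affine algebra in Drinfeld's realization -/

/-- The generators: `gh = γ^{1/2}`, its inverse, `k_i`, `k_i⁻¹`, the grading element `d`,
the `a_i(n)` with `n ≠ 0`, and the `x_i^ε(n)` with a sign `ε`. -/
inductive Gen (l : ℕ) : Type
  | gh : Gen l
  | ghInv : Gen l
  | k (i : Fin l) : Gen l
  | kInv (i : Fin l) : Gen l
  | d : Gen l
  | a (i : Fin l) (n : ℤ) (hn : n ≠ 0) : Gen l
  | x (ε : ℤˣ) (i : Fin l) (n : ℤ) : Gen l

namespace Free

/-- The free algebra on the generators. -/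
abbrev Alg (l : ℕ) : Type := FreeAlgebra ℂ (Gen l)

variable {l : ℕ}

/-- A generator as an element of the free algebra. -/
abbrev g (y : Gen l) : Alg l := FreeAlgebra.ι ℂ y

/-- The integral powers `γ^{m/2}`. -/
def ghPow (m : ℤ) : Alg l := if 0 ≤ m then g .gh ^ m.toNat else g .ghInv ^ (-m).toNat

/-- `a_i(n)` for `n ≠ 0` (and `0` for `n = 0`, a value that plays no role). -/
def a (i : Fin l) (n : ℤ) : Alg l := if hn : n ≠ 0 then g (.a i n hn) else 0

/-- `x_i^ε(n)`. -/
abbrev x (ε : ℤˣ) (i : Fin l) (n : ℤ) : Alg l := g (.x ε i n)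

/-- `ψ_i(n)`, where
`∑_{n ≥ 0} ψ_i(n) z^{-n} = k_i exp ((q - q⁻¹) ∑_{n > 0} a_i(n) z^{-n})`, and `ψ_i(n) = 0` for
`n < 0`. -/
def psi (h : ℂ) (i : Fin l) (n : ℤ) : Alg l :=
  if 0 ≤ n then
    g (.k i) * PowerSeries.coeff n.toNat (expSeries (PowerSeries.mk fun r : ℕ =>
      if r = 0 then 0 else (qpow h 1 - qpow h (-1)) • a i (r : ℤ)))
  else 0

/-- `φ_i(n)`, where
`∑_{n ≥ 0} φ_i(-n) z^n = k_i⁻¹ exp ((q⁻¹ - q) ∑_{n > 0} a_i(-n) z^n)`, and `φ_i(n) = 0` for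
`n > 0`. -/
def phi (h : ℂ) (i : Fin l) (n : ℤ) : Alg l :=
  if n ≤ 0 then
    g (.kInv i) * PowerSeries.coeff (-n).toNat (expSeries (PowerSeries.mk fun r : ℕ =>
      if r = 0 then 0 else (qpow h (-1) - qpow h 1) • a i (-(r : ℤ))))
  else 0

end Free

open Free in
/-- The defining relations of the quantum affine algebra, in components. -/
inductive Rel (T : DynkinType) (h : ℂ) : Alg T.rank → Alg T.rank → Prop
  | gh_mul_inv : Rel T h (g .gh * g .ghInv) 1
  | inv_mul_gh : Rel T h (g .ghInv * g .gh) 1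
  | gh_central (y : Gen T.rank) : Rel T h (g .gh * g y) (g y * g .gh)
  | k_mul_inv (i : Fin T.rank) : Rel T h (g (.k i) * g (.kInv i)) 1
  | inv_mul_k (i : Fin T.rank) : Rel T h (g (.kInv i) * g (.k i)) 1
  | k_k (i j : Fin T.rank) : Rel T h (g (.k i) * g (.k j)) (g (.k j) * g (.k i))
  | k_d (i : Fin T.rank) : Rel T h (g (.k i) * g .d) (g .d * g (.k i))
  | k_a (i j : Fin T.rank) (n : ℤ) (hn : n ≠ 0) :
      Rel T h (g (.k i) * a j n) (a j n * g (.k i))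
  | k_x (ε : ℤˣ) (i j : Fin T.rank) (n : ℤ) :
      Rel T h (g (.k i) * x ε j n)
        (qpow h (((ε : ℤ) : ℚ) * T.form i j) • (x ε j n * g (.k i)))
  | d_a (i : Fin T.rank) (n : ℤ) (hn : n ≠ 0) :
      Rel T h (g .d * a i n - a i n * g .d) ((n : ℂ) • a i n)
  | d_x (ε : ℤˣ) (i : Fin T.rank) (n : ℤ) :
      Rel T h (g .d * x ε i n - x ε i n * g .d) ((n : ℂ) • x ε i n)
  /-- `[a_i(m), a_j(n)] = δ_{m,-n} [(α_i|α_j) m] / m * (γ^m - γ^{-m}) / (q - q⁻¹)` -/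
  | a_a (i j : Fin T.rank) (m n : ℤ) (hm : m ≠ 0) (hn : n ≠ 0) :
      Rel T h (a i m * a j n - a j n * a i m)
        (if m + n = 0 then
          (qnum h (T.form i j * m) / (m : ℂ) / (qpow h 1 - qpow h (-1))) •
            (ghPow (2 * m) - ghPow (-(2 * m)))
        else 0)
  /-- `[a_i(m), x_j^±(n)] = ± [(α_i|α_j) m] / m * γ^{∓|m|/2} x_j^±(m + n)` -/
  | a_x (ε : ℤˣ) (i j : Fin T.rank) (m n : ℤ) (hm : m ≠ 0) :
      Rel T h (a i m * x ε j n - x ε j n * a i m)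
        ((((ε : ℤ) : ℂ) * (qnum h (T.form i j * m) / (m : ℂ))) •
          (ghPow (-((ε : ℤ) * |m|)) * x ε j (m + n)))
  /-- `(z - q^{±(α_i|α_j)} w) x_i^±(z) x_j^±(w) = (q^{±(α_i|α_j)} z - w) x_j^±(w) x_i^±(z)` -/
  | x_x (ε : ℤˣ) (i j : Fin T.rank) (m n : ℤ) :
      Rel T h
        (x ε i (m + 1) * x ε j n
          - qpow h (((ε : ℤ) : ℚ) * T.form i j) • (x ε i m * x ε j (n + 1)))
        (qpow h (((ε : ℤ) : ℚ) * T.form i j) • (x ε j n * x ε i (m + 1))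
          - x ε j (n + 1) * x ε i m)
  /-- `[x_i^+(m), x_j^-(n)] = δ_{ij} / (q_i - q_i⁻¹) *
  (γ^{(m-n)/2} ψ_i(m+n) - γ^{(n-m)/2} φ_i(m+n))` -/
  | xp_xm (i j : Fin T.rank) (m n : ℤ) :
      Rel T h (x 1 i m * x (-1) j n - x (-1) j n * x 1 i m)
        (if i = j then
          (qpow h (T.halfSq i) - qpow h (-(T.halfSq i)))⁻¹ •
            (ghPow (m - n) * psi h i (m + n) - ghPow (n - m) * phi h i (m + n))
        else 0)
  /-- The Serre relations: for `i ≠ j`, `N = 1 - A_{ij}`,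
  `Sym_{m_1, …, m_N} ∑_s (-1)^s [N choose s]_i
    x_i^±(m_1) ⋯ x_i^±(m_s) x_j^±(n) x_i^±(m_{s+1}) ⋯ x_i^±(m_N) = 0` -/
  | serre (ε : ℤˣ) (i j : Fin T.rank) (hij : i ≠ j) (N : ℕ) (hN : (N : ℤ) = 1 - T.cartan i j)
      (m : Fin N → ℤ) (n : ℤ) :
      Rel T h
        (∑ σ : Equiv.Perm (Fin N), ∑ s ∈ Finset.range (N + 1),
          ((-1 : ℂ) ^ s * qbinom h (T.halfSq i) N s) •
            (((List.ofFn fun t => x ε i (m (σ t))).take s).prod * x ε j n *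
              ((List.ofFn fun t => x ε i (m (σ t))).drop s).prod))
        0

/-- The quantum affine algebra `U_q(ĝ)` of untwisted type, `q = exp h`. -/
abbrev Uq (T : DynkinType) (h : ℂ) : Type := RingQuot (Rel T h)

/-- The canonical projection from the free algebra. -/
def Uq.mk (T : DynkinType) (h : ℂ) : FreeAlgebra ℂ (Gen T.rank) →ₐ[ℂ] Uq T h :=
  RingQuot.mkAlgHom ℂ (Rel T h)

section Modules

variable (T : DynkinType) (h : ℂ) (k : ℚ) (V : Type*) [AddCommGroup V] [Module ℂ V]
  [Module (Uq T h) V] [IsScalarTower ℂ (Uq T h) V]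

/-- The operator on `V` by which (the class of) an element of the free algebra acts. -/
def op (u : FreeAlgebra ℂ (Gen T.rank)) : Module.End ℂ V :=
  Algebra.lsmul ℂ ℂ V (Uq.mk T h u)

/-- The operator `d` on `V`; the homogeneous subspaces `V_a` are its eigenspaces. -/
def dOp : Module.End ℂ V := op T h V (Free.g .d)

/-- The operator `k_i` on `V`. -/
def kOp (i : Fin T.rank) : Module.End ℂ V := op T h V (Free.g (.k i))

/-- The operator `a_i(n)` on `V`. -/
def aOp (i : Fin T.rank) (n : ℤ) : Module.End ℂ V := op T h V (Free.a i n)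

/-- The operator `x_i^ε(n)` on `V`. -/
def xOp (ε : ℤˣ) (i : Fin T.rank) (n : ℤ) : Module.End ℂ V := op T h V (Free.x ε i n)

/-- The category of `U_q(ĝ)`-modules of level `k` under consideration. -/
structure InCategory : Prop where
  /-- `γ = q^c` acts as `q^k`, with square root `γ^{1/2} = q^{c/2}` acting as `q^{k/2}`. -/
  level : op T h V (Free.g .gh) = qpow h (k / 2) • (1 : Module.End ℂ V)
  /-- `V` is the sum (automatically direct) of its homogeneous subspaces `V_a`. -/
  graded : (⨆ a : ℂ, (dOp T h V).eigenspace a) = ⊤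
  /-- The weight spaces (simultaneous eigenspaces of `d` and all `k_i`) are finite dimensional. -/
  finite_weight : ∀ (a : ℂ) (κ : Fin T.rank → ℂ), FiniteDimensional ℂ
    ((dOp T h V).eigenspace a ⊓ ⨅ i, (kOp T h V i).eigenspace (κ i) : Submodule ℂ V)
  /-- For each `a` the degrees `a + n` that occur are bounded above. -/
  truncated : ∀ a : ℂ, ∃ n₀ : ℕ, ∀ n : ℕ, n₀ < n → (dOp T h V).eigenspace (a + n) = ⊥

/-- `E_+^ε(η α_i, z) = exp (ε ∑_{n ≥ 1} q^{-ε k n / 2} / [k n] * (η a_i(n)) z^{-n})`, as a power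
series in `z⁻¹`; here `ε` and `η` are signs. -/
def EPlus (ε η : ℤˣ) (i : Fin T.rank) : PowerSeries (Module.End ℂ V) :=
  expSeries (PowerSeries.mk fun n : ℕ => if n = 0 then 0 else
    (((ε : ℤ) : ℂ) * ((η : ℤ) : ℂ) *
      (qpow h (-(((ε : ℤ) : ℚ) * k * n / 2)) / qnum h (k * n))) • aOp T h V i (n : ℤ))

/-- `E_-^ε(α_i, z) = exp (- ε ∑_{n ≥ 1} q^{-ε k n / 2} / [k n] * a_i(-n) z^n)`, as a power
series in `z`. -/
def EMinus (ε : ℤˣ) (i : Fin T.rank) : PowerSeries (Module.End ℂ V) :=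
  expSeries (PowerSeries.mk fun n : ℕ => if n = 0 then 0 else
    (-((ε : ℤ) : ℂ) *
      (qpow h (-(((ε : ℤ) : ℚ) * k * n / 2)) / qnum h (k * n))) • aOp T h V i (-(n : ℤ)))

variable {V} in
/-- The summand of `Z_i^ε(n) v` indexed by `(p, r)`: the coefficient of `z^p` in
`E_-^ε(α_i, z)`, times `x_i^ε(n + p - r)`, times the coefficient of `z^{-r}` in
`E_+^ε(α_i, z)`, applied to `v`. -/
def ZTerm (ε : ℤˣ) (i : Fin T.rank) (n : ℤ) (v : V) (pr : ℕ × ℕ) : V :=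
  PowerSeries.coeff pr.1 (EMinus T h k V ε i)
    (xOp T h V ε i (n + pr.1 - pr.2)
      (PowerSeries.coeff pr.2 (EPlus T h k V ε 1 i) v))

variable {V} in
/-- The quantum `Z`-operators: `Z_i^ε(n)` is the coefficient of `z^{-n}` in
`E_-^ε(α_i, z) x_i^ε(z) E_+^ε(α_i, z)`, where `x_i^ε(z) = ∑ x_i^ε(m) z^{-m}`.  For modules in
the category the sum has only finitely many nonzero terms. -/
def ZOp (ε : ℤˣ) (i : Fin T.rank) (n : ℤ) (v : V) : V :=
  ∑ᶠ pr : ℕ × ℕ, ZTerm T h k ε i n v pr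

/-- The vacuum space: all `v` with `E_+^±(α_i, z) v = v` and `E_+^±(-α_i, z) v = v`, for all
`i`. -/
def vacuum : Submodule ℂ V where
  carrier := {v | ∀ (ε η : ℤˣ) (i : Fin T.rank) (N : ℕ),
    PowerSeries.coeff N (EPlus T h k V ε η i) v = if N = 0 then v else 0}
  add_mem' := by
    intro v w hv hw ε η i N
    rw [map_add, hv ε η i N, hw ε η i N]
    split_ifs <;> simp
  zero_mem' := by
    intro ε η i N
    simp
  smul_mem' := by
    intro c v hv ε η i N
    rw [map_smul, hv ε η i N]
    split_ifs <;> simp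

/-- A subspace is stable under all quantum `Z`-operators. -/
def ZStable (W : Submodule ℂ V) : Prop :=
  ∀ (ε : ℤˣ) (i : Fin T.rank) (n : ℤ), ∀ w ∈ W, ZOp T h k ε i n w ∈ W

/-- A subspace `Ω` is irreducible under the quantum `Z`-operators: it is nonzero and stable, and
its only stable subspaces are `0` and `Ω`. -/
structure ZIrreducible (Ω : Submodule ℂ V) : Prop where
  stable : ZStable T h k V Ω
  ne_bot : Ω ≠ ⊥
  eq_bot_or_eq : ∀ W : Submodule ℂ V, W ≤ Ω → ZStable T h k V W → W = ⊥ ∨ W = Ω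

end Modules

end

end QuantumZ

/-!
In level `k ≠ 0` the operators `a_i(n)` form a Heisenberg algebra.  The brackets
`[a_i(m), a_j(-m)]` form a nondegenerate matrix, a nonzero multiple of a symmetrized quantum Cartan
matrix at `q^m`, so a change of basis turns the `a_i(n)` into independent oscillators, and the
vacuum space `Ω` is the common kernel of the annihilation operators `a_i(n)`, `n > 0`.  As the
degrees are bounded above, number operators show that `V` is generated by `Ω` under the creation
operators `a_i(-n)`, and that `Ω` meets the sum of their ranges only in `0`.

The factors `E_∓` make the `Z`-operators commute with all `a_i(n)`.  Hence the `Z`-operators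
preserve `Ω`, and a `Z`-stable subspace of `Ω` generates, under the creation operators, a `Z`-stable
subspace of `V`.  Since `E_∓` have constant term `1`, the `x_i^±(n)` are recovered from the
`Z`-operators, so this subspace is stable under all generators but `d`.  When `V` is simple it is
nevertheless everything: as the degrees are bounded above, it contains a nonzero vector that is
killed by all monomials of positive degree, and such a vector is homogeneous, so that what it
generates is stable under `d`.
-/

namespace QuantumZ

noncomputable section

/-! ### Exponential series over a noncommutative algebra -/

section ExpSeries

open PowerSeries

variable {R : Type*} [Ring R]

theorem coeff_pow_eq_zero_of_lt {f : R⟦X⟧} (h0 : coeff 0 f = 0) {j N : ℕ}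
    (h : N < j) : coeff N (f ^ j) = 0 :=
  coeff_of_lt_order N ((Nat.cast_lt.mpr h).trans_le
    (le_order_pow_of_constantCoeff_eq_zero j (by simpa using h0)))

theorem commutator_pow_succ {a f b : R} (hab : a * f - f * a = b) (hb : Commute b f) (j : ℕ) :
    a * f ^ (j + 1) - f ^ (j + 1) * a = (j + 1) • (b * f ^ j) := by
  induction j with
  | zero => simp [hab]
  | succ j ih =>
    calc a * f ^ (j + 2) - f ^ (j + 2) * a
        = (a * f ^ (j + 1) - f ^ (j + 1) * a) * f + f ^ (j + 1) * (a * f - f * a) := by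
          rw [pow_succ f (j + 1)]; noncomm_ring
      _ = (j + 1) • (b * f ^ (j + 1)) + b * f ^ (j + 1) := by
          rw [ih, hab, smul_mul_assoc, mul_assoc, ← pow_succ, (hb.pow_right (j + 1)).eq]
      _ = (j + 2) • (b * f ^ (j + 1)) := (succ_nsmul _ _).symm

variable [Algebra ℂ R]

theorem coeff_pow_mem_of_graded {A : ℕ → Submodule ℂ R} [SetLike.GradedMonoid A]
    {f : R⟦X⟧} (hf : ∀ n, coeff n f ∈ A n) (j N : ℕ) :
    coeff N (f ^ j) ∈ A N := by
  induction j generalizing N with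
  | zero =>
    rw [pow_zero, coeff_one]
    split_ifs with h
    · exact h ▸ SetLike.GradedOne.one_mem
    · exact zero_mem _
  | succ j ih =>
    rw [pow_succ, coeff_mul]
    refine sum_mem fun p hp => ?_
    rw [← Finset.HasAntidiagonal.mem_antidiagonal.mp hp]
    exact SetLike.GradedMul.mul_mem (ih _) (hf _)

theorem coeff_expSeries_mem_of_graded {A : ℕ → Submodule ℂ R} [SetLike.GradedMonoid A]
    {f : R⟦X⟧} (hf : ∀ n, coeff n f ∈ A n) (N : ℕ) :
    coeff N (expSeries f) ∈ A N := by
  rw [expSeries, coeff_mk]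
  exact sum_mem fun j _ => Submodule.smul_mem _ _ (coeff_pow_mem_of_graded hf j N)

theorem coeff_expSeries_mem {S : Subalgebra ℂ R} {f : R⟦X⟧}
    (hf : ∀ n, coeff n f ∈ S) (N : ℕ) : coeff N (expSeries f) ∈ S := by
  have : SetLike.GradedMonoid fun _ : ℕ => S.toSubmodule :=
    { one_mem := S.one_mem, mul_mem := fun _ _ _ _ => S.mul_mem }
  exact coeff_expSeries_mem_of_graded (A := fun _ => S.toSubmodule) hf N

@[simp] theorem coeff_zero_expSeries (f : R⟦X⟧) :
    coeff 0 (expSeries f) = 1 := by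
  simp [expSeries]

theorem commutator_coeff_pow_succ {a : R} {c : ℂ} {m : ℕ} {f : R⟦X⟧}
    (hf : ∀ n, a * coeff n f - coeff n f * a
      = if n = m then c • (1 : R) else 0) (j N : ℕ) :
    a * coeff N (f ^ (j + 1)) - coeff N (f ^ (j + 1)) * a
      = if m ≤ N then (((j + 1 : ℕ) : ℂ) * c) • coeff (N - m) (f ^ j) else 0 := by
  have hC : C a * f - f * C a = c • (X ^ m : R⟦X⟧) := by
    ext n
    rw [map_sub, coeff_C_mul, coeff_mul_C, hf, coeff_smul,
      coeff_X_pow]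
    split_ifs <;> simp
  have hcomm : Commute (c • (X ^ m : R⟦X⟧)) f :=
    ((commute_X_pow f m).symm).smul_left c
  have key := congrArg (coeff N) (commutator_pow_succ hC hcomm j)
  rw [map_sub, coeff_C_mul, coeff_mul_C] at key
  rw [key, smul_mul_assoc, map_nsmul, coeff_smul, coeff_X_pow_mul',
    ← Nat.cast_smul_eq_nsmul ℂ, smul_smul]
  split_ifs <;> simp

/-- Bracketing with `a` is a derivation, so it multiplies the exponential by `[a, f(z)]` as soon as
this bracket is central. -/
theorem commutator_coeff_expSeries {a : R} {c : ℂ} {m : ℕ} (hm : 0 < m) {f : R⟦X⟧}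
    (h0 : coeff 0 f = 0)
    (hf : ∀ n, a * coeff n f - coeff n f * a
      = if n = m then c • (1 : R) else 0) (N : ℕ) :
    a * coeff N (expSeries f) - coeff N (expSeries f) * a
      = if m ≤ N then c • coeff (N - m) (expSeries f) else 0 := by
  have hone : a * coeff N (1 : R⟦X⟧) - coeff N 1 * a = 0 := by
    rw [coeff_one]; split_ifs <;> simp
  simp only [expSeries, coeff_mk, Finset.mul_sum, Finset.sum_mul, mul_smul_comm,
    smul_mul_assoc, ← Finset.sum_sub_distrib, ← smul_sub]
  rw [Finset.sum_range_succ', pow_zero, hone, smul_zero, add_zero]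
  simp only [commutator_coeff_pow_succ hf]
  split_ifs with hmN
  · rw [Finset.smul_sum, ← Finset.sum_subset (Finset.range_subset_range.mpr
      (show N - m + 1 ≤ N by omega))]
    · refine Finset.sum_congr rfl fun j _ => ?_
      have : ((j.factorial : ℂ)) ≠ 0 := by exact_mod_cast j.factorial_ne_zero
      have : ((j + 1 : ℕ) : ℂ) ≠ 0 := by exact_mod_cast j.succ_ne_zero
      rw [smul_smul, smul_smul, Nat.factorial_succ, Nat.cast_mul]
      congr 1
      field_simp
    · intro j _ hj
      rw [Finset.mem_range, not_lt] at hj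
      rw [coeff_pow_eq_zero_of_lt h0 (by omega), smul_zero, smul_zero]
  · simp

/-- The series `exp (∑_{n ≥ 1} c_n f_n z^n)`. -/
def expSum (c : ℕ → ℂ) (f : ℕ → R) : R⟦X⟧ :=
  expSeries (mk fun n => if n = 0 then 0 else c n • f n)

theorem coeff_expSum_mem_of_graded {A : ℕ → Submodule ℂ R} [SetLike.GradedMonoid A] (c : ℕ → ℂ)
    {f : ℕ → R} (hf : ∀ n, f n ∈ A n) (N : ℕ) : coeff N (expSum c f) ∈ A N := by
  refine coeff_expSeries_mem_of_graded (fun n => ?_) N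
  rw [coeff_mk]
  split_ifs
  · exact zero_mem _
  · exact Submodule.smul_mem _ _ (hf n)

theorem coeff_expSum_mem {S : Subalgebra ℂ R} (c : ℕ → ℂ) {f : ℕ → R}
    (hf : ∀ n, 0 < n → f n ∈ S) (N : ℕ) : coeff N (expSum c f) ∈ S := by
  refine coeff_expSeries_mem (fun n => ?_) N
  rw [coeff_mk]
  split_ifs with hn
  · exact zero_mem _
  · exact S.smul_mem (hf n (Nat.pos_of_ne_zero hn)) _

theorem commutator_coeff_expSum {a : R} {b : ℂ} {m : ℕ} (hm : 0 < m) (c : ℕ → ℂ) {f : ℕ → R}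
    (hf : ∀ n, 0 < n → a * f n - f n * a = if n = m then b • (1 : R) else 0) (N : ℕ) :
    a * coeff N (expSum c f) - coeff N (expSum c f) * a
      = if m ≤ N then (c m * b) • coeff (N - m) (expSum c f) else 0 := by
  refine commutator_coeff_expSeries hm (by simp) (fun n => ?_) N
  rw [coeff_mk]
  rcases Nat.eq_zero_or_pos n with rfl | hn
  · simp [hm.ne]
  · rw [if_neg hn.ne', mul_smul_comm, smul_mul_assoc, ← smul_sub, hf n hn]
    split_ifs with hnm
    · rw [hnm, smul_smul]
    · exact smul_zero _

theorem commute_coeff_expSum {a : R} (c : ℕ → ℂ) {f : ℕ → R}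
    (hf : ∀ n, 0 < n → Commute a (f n)) (N : ℕ) : Commute a (coeff N (expSum c f)) :=
  (Subalgebra.mem_centralizer_iff ℂ).mp
    (coeff_expSum_mem (S := Subalgebra.centralizer ℂ {a}) c
      (fun n hn => (Subalgebra.mem_centralizer_iff ℂ).mpr (by simpa using (hf n hn).eq)) N) a rfl

section Operators

variable {V : Type*} [AddCommGroup V] [Module ℂ V]

theorem coeff_mul_apply_eq_zero {f g : (Module.End ℂ V)⟦X⟧} {N : ℕ} {v : V}
    (h : ∀ p q, p + q = N → coeff p f (coeff q g v) = 0) : coeff N (f * g) v = 0 := by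
  rw [coeff_mul, LinearMap.sum_apply]
  exact Finset.sum_eq_zero fun p hp => h _ _ (Finset.HasAntidiagonal.mem_antidiagonal.mp hp)

theorem coeff_expSeries_apply_eq_of_forall_lt {f : (Module.End ℂ V)⟦X⟧} (h0 : coeff 0 f = 0)
    {N : ℕ} (hN : 0 < N) {v : V} (hv : ∀ n < N, coeff n f v = 0) :
    coeff N (expSeries f) v = coeff N f v := by
  rw [expSeries, coeff_mk, LinearMap.sum_apply,
    Finset.sum_eq_single_of_mem 1 (Finset.mem_range.mpr (by omega))]
  · simp
  rintro (_ | _ | j) - hj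
  · simp [coeff_one, hN.ne']
  · exact absurd rfl hj
  · rw [LinearMap.smul_apply, pow_succ, coeff_mul_apply_eq_zero, smul_zero]
    intro p q hpq
    rcases Nat.eq_zero_or_pos p with rfl | hp
    · rw [coeff_pow_eq_zero_of_lt h0 j.succ_pos, LinearMap.zero_apply]
    · rw [hv q (by omega), map_zero]

theorem coeff_expSeries_apply_eq_zero_iff {f : (Module.End ℂ V)⟦X⟧} (h0 : coeff 0 f = 0) {v : V} :
    (∀ N, 0 < N → coeff N (expSeries f) v = 0) ↔ ∀ n, coeff n f v = 0 := by
  refine ⟨fun hv n => ?_, fun hv N hN => ?_⟩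
  · induction n using Nat.strong_induction_on with
    | _ n ih =>
    rcases Nat.eq_zero_or_pos n with rfl | hn
    · rw [h0, LinearMap.zero_apply]
    · rw [← coeff_expSeries_apply_eq_of_forall_lt h0 hn ih, hv n hn]
  · rw [coeff_expSeries_apply_eq_of_forall_lt h0 hN fun n _ => hv n, hv]

theorem coeff_expSum_apply_eq_zero_iff {c : ℕ → ℂ} (hc : ∀ n, 0 < n → c n ≠ 0)
    {f : ℕ → Module.End ℂ V} {v : V} :
    (∀ N, 0 < N → coeff N (expSum c f) v = 0) ↔ ∀ n, 0 < n → f n v = 0 := by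
  rw [expSum, coeff_expSeries_apply_eq_zero_iff (by simp)]
  refine forall_congr' fun n => ?_
  rcases Nat.eq_zero_or_pos n with rfl | hn
  · simp
  · simp [hn, hn.ne', hc n hn]

end Operators

end ExpSeries

/-! ### Filtrations and stable subspaces -/

section Filtration

variable {K V : Type*} [Field K] [AddCommGroup V] [Module K V]

/-- An increasing exhaustive filtration that vanishes in nonpositive degrees.  The index measures
how far below the top degree a vector may reach. -/
structure IsTruncFiltration (F : ℤ → Submodule K V) : Prop where
  mono : Monotone F
  eq_bot : ∀ M ≤ 0, F M = ⊥
  exhaust : ∀ v, ∃ M : ℕ, v ∈ F M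

/-- Operators that raise the degree by `n`, hence lower the filtration index by `n`. -/
def degSub (F : ℤ → Submodule K V) (n : ℤ) : Submodule K (Module.End K V) where
  carrier := {f | ∀ M, ∀ v ∈ F M, f v ∈ F (M - n)}
  add_mem' hf hg M v hv := add_mem (hf M v hv) (hg M v hv)
  zero_mem' _ _ _ := zero_mem _
  smul_mem' c _ hf M v hv := Submodule.smul_mem _ c (hf M v hv)

/-- The algebra of operators that leave the subspace `S` stable. -/
def stabilizer (S : Submodule K V) : Subalgebra K (Module.End K V) where
  carrier := {f | ∀ v ∈ S, f v ∈ S}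
  mul_mem' hf hg v hv := hf _ (hg v hv)
  add_mem' hf hg v hv := add_mem (hf v hv) (hg v hv)
  algebraMap_mem' c _ hv := Submodule.smul_mem _ c hv

/-- The smallest subspace that contains `W` and is stable under the operators in `X`. -/
def orbit (X : Set (Module.End K V)) (W : Submodule K V) : Submodule K V :=
  sInf {S | W ≤ S ∧ X ⊆ stabilizer S}

section Orbit

variable {X : Set (Module.End K V)} {W S : Submodule K V}

theorem orbit_le (hW : W ≤ S) (hX : X ⊆ stabilizer S) : orbit X W ≤ S :=
  sInf_le ⟨hW, hX⟩

theorem le_orbit : W ≤ orbit X W := le_sInf fun _ h => h.1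

theorem subset_stabilizer_orbit : X ⊆ stabilizer (orbit X W) := fun _ hf v hv =>
  Submodule.mem_sInf.mpr fun S hS => hS.2 hf v (Submodule.mem_sInf.mp hv S hS)

theorem mem_stabilizer_orbit {f : Module.End K V} (hW : ∀ w ∈ W, f w ∈ orbit X W)
    (hX : ∀ g ∈ X, ∀ v ∈ orbit X W, f v ∈ orbit X W → f (g v) ∈ orbit X W) :
    f ∈ stabilizer (orbit X W) := by
  suffices h : orbit X W ≤ orbit X W ⊓ (orbit X W).comap f from fun v hv => (h hv).2
  exact orbit_le (fun w hw => ⟨le_orbit hw, hW w hw⟩)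
    fun g hg v hv => ⟨subset_stabilizer_orbit hg v hv.1, hX g hg v hv.1 hv.2⟩

end Orbit

variable {F : ℤ → Submodule K V}

theorem one_mem_degSub : (1 : Module.End K V) ∈ degSub F 0 := fun M v hv => by simpa using hv

theorem mul_mem_degSub {m n : ℤ} {f g : Module.End K V} (hf : f ∈ degSub F m)
    (hg : g ∈ degSub F n) : f * g ∈ degSub F (m + n) := fun M v hv => by
  have := hf _ _ (hg _ _ hv)
  rwa [sub_sub, add_comm n m] at this

theorem IsTruncFiltration.eq_zero (hF : IsTruncFiltration F) {M : ℤ} (hM : M ≤ 0) {v : V}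
    (hv : v ∈ F M) : v = 0 := by
  rwa [hF.eq_bot M hM] at hv

theorem IsTruncFiltration.exists_minimal (hF : IsTruncFiltration F) {S : Submodule K V}
    (hS : S ≠ ⊥) : ∃ M : ℤ, ∃ v ∈ S, v ∈ F M ∧ v ≠ 0 ∧ ∀ N < M, ∀ w ∈ S, w ∈ F N → w = 0 := by
  classical
  have hex : ∃ M : ℕ, ∃ v ∈ S, v ∈ F M ∧ v ≠ 0 := by
    obtain ⟨v, hv, hv0⟩ := Submodule.exists_mem_ne_zero_of_ne_bot hS
    obtain ⟨M, hM⟩ := hF.exhaust v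
    exact ⟨M, v, hv, hM, hv0⟩
  obtain ⟨v, hv, hvM, hv0⟩ := Nat.find_spec hex
  refine ⟨Nat.find hex, v, hv, hvM, hv0, fun N hN w hw hwN => ?_⟩
  by_contra hw0
  rcases le_or_gt N 0 with hN0 | hN0
  · exact hw0 (hF.eq_zero hN0 hwN)
  · lift N to ℕ using hN0.le
    exact Nat.find_min hex (by exact_mod_cast hN) ⟨w, hw, hwN, hw0⟩

end Filtration

/-! ### Dressed generating series -/

section Shift

variable {M V : Type*} [AddCommMonoid M] [PartialOrder M] [CanonicallyOrderedAdd M]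
  [Sub M] [OrderedSub M] [DecidableLE M] [AddCommMonoid V]

theorem finsum_ite_le_sub [IsOrderedCancelAddMonoid M] (m : M) (f : M → V) :
    ∑ᶠ p, (if m ≤ p then f (p - m) else 0) = ∑ᶠ p, f p := by
  classical
  have hrange : ∀ p, m ≤ p ↔ p ∈ Set.range (· + m) := fun p =>
    ⟨fun h => ⟨p - m, tsub_add_cancel_of_le h⟩, by rintro ⟨p, rfl⟩; exact le_add_self⟩
  calc ∑ᶠ p, (if m ≤ p then f (p - m) else 0)
      = ∑ᶠ p ∈ Set.range (· + m), f (p - m) := by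
        refine finsum_congr fun p => ?_
        rw [finsum_eq_if]
        exact if_congr (hrange p) rfl rfl
    _ = ∑ᶠ p, f p := by
        rw [finsum_mem_range (add_left_injective m)]
        simp only [add_tsub_cancel_right]

theorem finite_support_ite_le_sub (m : M) {f : M → V} (hf : (Function.support f).Finite) :
    (Function.support fun p => if m ≤ p then f (p - m) else 0).Finite := by
  refine (hf.image (· + m)).subset fun p hp => ?_
  obtain ⟨hmp, hp⟩ := ite_ne_right_iff.mp hp
  exact ⟨p - m, hp, tsub_add_cancel_of_le hmp⟩

end Shift

section Dressing

variable {K V : Type*} [Field K] [AddCommGroup V] [Module K V]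

/-- The summand `e⁻_p x_{n+p-r} e⁺_r v` of the `n`-th coefficient of `e⁻(z) x(z) e⁺(z) v`. -/
def dressTerm (em : ℕ → Module.End K V) (x : ℤ → Module.End K V) (ep : ℕ → Module.End K V)
    (n : ℤ) (v : V) (pr : ℕ × ℕ) : V :=
  em pr.1 (x (n + pr.1 - pr.2) (ep pr.2 v))

/-- The `n`-th coefficient of `e⁻(z) x(z) e⁺(z) v`. -/
def dressSum (em : ℕ → Module.End K V) (x : ℤ → Module.End K V) (ep : ℕ → Module.End K V)
    (n : ℤ) (v : V) : V :=
  ∑ᶠ pr : ℕ × ℕ, dressTerm em x ep n v pr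

variable {F : ℤ → Submodule K V} {em ep : ℕ → Module.End K V} {x : ℤ → Module.End K V}

theorem dressTerm_support_finite (hF : IsTruncFiltration F) (hx : ∀ n, x n ∈ degSub F n)
    (hep : ∀ r : ℕ, ep r ∈ degSub F r) (n : ℤ) (v : V) :
    (Function.support (dressTerm em x ep n v)).Finite := by
  obtain ⟨M, hM⟩ := hF.exhaust v
  refine (Finset.finite_toSet (Finset.range (M - n).toNat ×ˢ Finset.range M)).subset
    fun ⟨p, r⟩ hpr => ?_
  by_contra hout
  simp only [Finset.coe_product, Finset.coe_range, Set.mem_prod, Set.mem_Iio, not_and_or,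
    not_lt] at hout
  have hr : ep r v ∈ F (M - r) := hep r _ _ hM
  have hxr : x (n + p - r) (ep r v) ∈ F (M - r - (n + p - r)) := hx _ _ _ hr
  have hzero : x (n + p - r) (ep r v) = 0 := by
    rcases hout with h | h
    · exact hF.eq_zero (by omega) hxr
    · rw [hF.eq_zero (by omega) hr, map_zero]
  exact hpr (by rw [dressTerm, hzero, map_zero])

theorem isLinearMap_dressSum (hF : IsTruncFiltration F) (hx : ∀ n, x n ∈ degSub F n)
    (hep : ∀ r : ℕ, ep r ∈ degSub F r) (n : ℤ) : IsLinearMap K (dressSum em x ep n) where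
  map_add v w := by
    rw [dressSum, dressSum, dressSum, ← finsum_add_distrib (dressTerm_support_finite hF hx hep n v)
      (dressTerm_support_finite hF hx hep n w)]
    exact finsum_congr fun pr => by simp only [dressTerm, map_add]
  map_smul c v := by
    rw [dressSum, dressSum, smul_finsum]
    exact finsum_congr fun pr => by simp only [dressTerm, map_smul]

theorem dressSum_mem {S : Submodule K V} (hem : ∀ p, em p ∈ stabilizer S)
    (hx : ∀ n, x n ∈ stabilizer S) (hep : ∀ r, ep r ∈ stabilizer S) (n : ℤ) {v : V} (hv : v ∈ S) :
    dressSum em x ep n v ∈ S :=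
  finsum_induction (· ∈ S) (zero_mem S) (fun _ _ => add_mem)
    fun _ => hem _ _ (hx _ _ (hep _ _ hv))

section Commutator

variable {A : Module.End K V} {b c d : K} {m : ℤ} {s t : ℕ}

theorem commutator_dressTerm
    (hAm : ∀ p, A * em p - em p * A = if s ≤ p then b • em (p - s) else 0)
    (hAx : ∀ n, A * x n - x n * A = c • x (m + n))
    (hAp : ∀ r, A * ep r - ep r * A = if t ≤ r then d • ep (r - t) else 0)
    (n : ℤ) (v : V) (pr : ℕ × ℕ) :
    A (dressTerm em x ep n v pr) - dressTerm em x ep n (A v) pr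
      = (if (s, 0) ≤ pr then (b • dressTerm em x ep (n + s) v) (pr - (s, 0)) else 0)
        + (c • dressTerm em x ep (n + m) v) pr
        + (if (0, t) ≤ pr then (d • dressTerm em x ep (n - t) v) (pr - (0, t)) else 0) := by
  obtain ⟨p, r⟩ := pr
  have hm := LinearMap.congr_fun (hAm p) (x (n + p - r) (ep r v))
  have hx := congrArg (em p) (LinearMap.congr_fun (hAx (n + p - r)) (ep r v))
  have hp := congrArg (fun w => em p (x (n + p - r) w)) (LinearMap.congr_fun (hAp r) v)
  simp only [LinearMap.sub_apply, Module.End.mul_apply, LinearMap.smul_apply, map_sub,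
    map_smul] at hm hx hp
  have hsplit : A (em p (x (n + p - r) (ep r v))) - em p (x (n + p - r) (ep r (A v)))
      = (if s ≤ p then b • em (p - s) else 0 : Module.End K V) (x (n + p - r) (ep r v))
        + c • em p (x (m + (n + p - r)) (ep r v))
        + em p (x (n + p - r) ((if t ≤ r then d • ep (r - t) else 0 : Module.End K V) v)) := by
    rw [← hm, ← hx, ← hp]; abel
  simp only [Pi.smul_apply, dressTerm, Prod.mk_le_mk, zero_le, and_true, true_and,
    Prod.mk_sub_mk, tsub_zero]
  rw [hsplit]
  congr 1
  · congr 1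
    · split_ifs with hs
      · rw [LinearMap.smul_apply, Nat.cast_sub hs]; congr 4; ring
      · rfl
    · congr 4; ring
  · split_ifs with ht
    · rw [LinearMap.smul_apply, map_smul, map_smul, Nat.cast_sub ht]; congr 4; ring
    · simp

theorem commutator_dressSum (hF : IsTruncFiltration F) (hx : ∀ n, x n ∈ degSub F n)
    (hep : ∀ r : ℕ, ep r ∈ degSub F r)
    (hAm : ∀ p, A * em p - em p * A = if s ≤ p then b • em (p - s) else 0)
    (hAx : ∀ n, A * x n - x n * A = c • x (m + n))
    (hAp : ∀ r, A * ep r - ep r * A = if t ≤ r then d • ep (r - t) else 0) (n : ℤ) (v : V) :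
    A (dressSum em x ep n v) - dressSum em x ep n (A v)
      = b • dressSum em x ep (n + s) v + c • dressSum em x ep (n + m) v
        + d • dressSum em x ep (n - t) v := by
  have hfin' : ∀ n w, (Function.support (dressTerm em x ep n w)).Finite :=
    dressTerm_support_finite hF hx hep
  have hfin : ∀ (c : K) (n : ℤ), (Function.support (c • dressTerm em x ep n v)).Finite :=
    fun c n => (hfin' n v).subset (Function.support_const_smul_subset c _)
  have hA : A (dressSum em x ep n v) = ∑ᶠ pr, A (dressTerm em x ep n v pr) :=
    A.toAddMonoidHom.map_finsum (hfin' n v)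
  have hAfin : (Function.support fun pr => A (dressTerm em x ep n v pr)).Finite :=
    (hfin' n v).subset (Function.support_comp_subset (map_zero A) _)
  rw [hA, dressSum, ← finsum_sub_distrib hAfin (hfin' n _),
    finsum_congr (commutator_dressTerm hAm hAx hAp n v),
    finsum_add_distrib (((finite_support_ite_le_sub _ (hfin b _)).union (hfin c _)).subset
      (Function.support_add _ _)) (finite_support_ite_le_sub _ (hfin d _)),
    finsum_add_distrib (finite_support_ite_le_sub _ (hfin b _)) (hfin c _),
    finsum_ite_le_sub, finsum_ite_le_sub]
  simp only [dressSum, smul_finsum, Pi.smul_apply]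

end Commutator

theorem sub_dressSum_mem (hF : IsTruncFiltration F) (hx : ∀ n, x n ∈ degSub F n)
    (hep : ∀ r : ℕ, ep r ∈ degSub F r) (hem0 : em 0 = 1) (hep0 : ep 0 = 1) {S : Submodule K V}
    {n : ℤ} {v : V} (hS : ∀ pr ≠ (0, 0), dressTerm em x ep n v pr ∈ S) :
    x n v - dressSum em x ep n v ∈ S := by
  classical
  have hfin := dressTerm_support_finite (em := em) hF hx hep n v
  have hsum : dressSum em x ep n v
      = ∑ pr ∈ insert (0, 0) hfin.toFinset, dressTerm em x ep n v pr :=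
    finsum_eq_sum_of_support_subset _ (by simp)
  have h00 : dressTerm em x ep n v (0, 0) = x n v := by simp [dressTerm, hem0, hep0]
  rw [hsum, ← Finset.add_sum_erase _ _ (Finset.mem_insert_self _ _), h00, sub_add_cancel_left]
  exact neg_mem (sum_mem fun pr hpr => hS pr (Finset.ne_of_mem_erase hpr))

/-- Conversely to `dressSum_mem`, the coefficients of `x(z)` are recovered from the dressed ones:
in the `n`-th dressed coefficient, all terms but `x_n v` involve `x_{n'} v` with `n' > n` or
`x_{n'} v'` with `v'` of lower filtration index. -/
theorem mem_stabilizer_of_dressSum_mem (hF : IsTruncFiltration F) (hx : ∀ n, x n ∈ degSub F n)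
    (hep : ∀ r : ℕ, ep r ∈ degSub F r) (hem0 : em 0 = 1) (hep0 : ep 0 = 1) {S : Submodule K V}
    (hem : ∀ p, em p ∈ stabilizer S) (hepS : ∀ r, ep r ∈ stabilizer S)
    (hZ : ∀ n, ∀ v ∈ S, dressSum em x ep n v ∈ S) (n : ℤ) : x n ∈ stabilizer S := by
  suffices main : ∀ M : ℕ, ∀ v ∈ S, v ∈ F M → ∀ n, x n v ∈ S by
    intro v hv
    obtain ⟨M, hM⟩ := hF.exhaust v
    exact main M v hv hM n
  intro M
  induction M using Nat.strong_induction_on with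
  | _ M ihM =>
  intro v hv hvM
  suffices inner : ∀ j : ℕ, ∀ n : ℤ, M - n ≤ j → x n v ∈ S from
    fun n => inner (M - n).toNat n (Int.self_le_toNat _)
  intro j
  induction j with
  | zero =>
    intro n hn
    rw [hF.eq_zero (by simpa using hn) (hx n _ _ hvM)]
    exact zero_mem _
  | succ j ihj =>
    intro n hn
    rw [← sub_add_cancel (x n v) (dressSum em x ep n v)]
    refine add_mem (sub_dressSum_mem hF hx hep hem0 hep0 ?_) (hZ n v hv)
    rintro ⟨p, r⟩ hpr
    refine hem _ _ ?_
    rcases Nat.eq_zero_or_pos r with rfl | hr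
    · have hp : p ≠ 0 := fun h => hpr (by rw [h])
      simpa only [hep0, Module.End.one_apply] using ihj _ (by push_cast; omega)
    · have hrv := hep r _ _ hvM
      rcases le_or_gt r M with hrM | hrM
      · exact ihM (M - r) (by omega) _ (hepS _ _ hv) (by rwa [Nat.cast_sub hrM]) _
      · rw [hF.eq_zero (by omega) hrv, map_zero]
        exact zero_mem _

end Dressing

/-! ### Systems of oscillators -/

theorem semiconjBy_aeval {K R : Type*} [CommSemiring K] [Semiring R] [Algebra K R] {a x y : R}
    (h : SemiconjBy a x y) (p : Polynomial K) :
    SemiconjBy a (Polynomial.aeval x p) (Polynomial.aeval y p) := by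
  induction p using Polynomial.induction_on' with
  | add p q hp hq => simpa only [map_add] using hp.add_right hq
  | monomial n c =>
    have hc : SemiconjBy a (algebraMap K R c) (algebraMap K R c) := (Algebra.commutes c a).symm
    simpa only [Polynomial.aeval_monomial] using hc.mul_right (h.pow_right n)

section Oscillators

variable {K V κ : Type*} [Field K] [AddCommGroup V] [Module K V]

/-- The vectors killed by all the annihilation operators `a i`. -/
def commonKernel (a : κ → Module.End K V) : Submodule K V := ⨅ i, LinearMap.ker (a i)

/-- The span of the images of the creation operators `c i`. -/
def creationRange (c : κ → Module.End K V) : Submodule K V := ⨆ i, LinearMap.range (c i)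

/-- The number operator of the oscillators in the finite set `s`. -/
def numberOp (a c : κ → Module.End K V) (s : Finset κ) : Module.End K V := ∑ i ∈ s, c i * a i

theorem mem_commonKernel {a : κ → Module.End K V} {v : V} :
    v ∈ commonKernel a ↔ ∀ i, a i v = 0 := by
  simp only [commonKernel, Submodule.mem_iInf, LinearMap.mem_ker]

theorem aeval_numberOp_descPochhammer_succ (a c : κ → Module.End K V) (s : Finset κ) (M : ℕ) :
    Polynomial.aeval (numberOp a c s) (descPochhammer K (M + 1))
      = numberOp a c s * Polynomial.aeval (numberOp a c s - 1) (descPochhammer K M) := by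
  rw [descPochhammer_succ_left, map_mul, Polynomial.aeval_X, Polynomial.aeval_comp]
  simp

variable [DecidableEq κ]

/-- Independent oscillators `[a_i, c_j] = δ_{ij}`, where `a_i` raises the degree by `w i` and `c_i`
lowers it by as much. -/
structure IsOscillatorSystem (F : ℤ → Submodule K V) (w : κ → ℕ) (a c : κ → Module.End K V) :
    Prop where
  weight_pos : ∀ i, 0 < w i
  finite_weight_le : ∀ M, {i | w i ≤ M}.Finite
  ann_mem : ∀ i, a i ∈ degSub F (w i)
  cre_mem : ∀ i, c i ∈ degSub F (-w i)
  ann_comm : ∀ i j, Commute (a i) (a j)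
  cre_comm : ∀ i j, Commute (c i) (c j)
  ann_cre : ∀ i j, a i * c j - c j * a i = if i = j then 1 else 0

namespace IsOscillatorSystem

variable {F : ℤ → Submodule K V} {w : κ → ℕ} {a c : κ → Module.End K V}

theorem semiconjBy_cre (hac : IsOscillatorSystem F w a c) {s : Finset κ} {i : κ} (hi : i ∈ s) :
    SemiconjBy (c i) (numberOp a c s) (numberOp a c s - 1) := by
  have hcomm : ∀ j, c i * (c j * a j) = c j * a j * c i - if i = j then c i else 0 := fun j => by
    have := congrArg (c j * ·) (hac.ann_cre j i)
    simp only [mul_sub, mul_ite, mul_one, mul_zero] at this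
    rw [← mul_assoc, (hac.cre_comm i j).eq, mul_assoc, mul_assoc, sub_eq_iff_eq_add.mp this]
    by_cases h : i = j
    · subst h; simp
    · simp [h, Ne.symm h]
  rw [SemiconjBy, numberOp, Finset.mul_sum, sub_mul, Finset.sum_mul, one_mul]
  simp only [hcomm, Finset.sum_sub_distrib, Finset.sum_ite_eq, if_pos hi]

theorem ann_mul_cre_mul_ann (hac : IsOscillatorSystem F w a c) (i j : κ) :
    a i * (c j * a j) = c j * a j * a i + if i = j then a i else 0 := by
  rw [← mul_assoc, sub_eq_iff_eq_add.mp (hac.ann_cre i j), add_mul, mul_assoc, mul_assoc,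
    (hac.ann_comm i j).eq, add_comm]
  by_cases h : i = j
  · subst h; simp
  · simp [h]

theorem semiconjBy_ann (hac : IsOscillatorSystem F w a c) {s : Finset κ} {i : κ} (hi : i ∈ s) :
    SemiconjBy (a i) (numberOp a c s - 1) (numberOp a c s) := by
  rw [SemiconjBy, numberOp, mul_sub, Finset.mul_sum, Finset.sum_mul, mul_one]
  simp only [hac.ann_mul_cre_mul_ann, Finset.sum_add_distrib, Finset.sum_ite_eq, if_pos hi,
    add_sub_cancel_right]

theorem commute_ann (hac : IsOscillatorSystem F w a c) {s : Finset κ} {i : κ} (hi : i ∉ s) :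
    Commute (a i) (numberOp a c s) := by
  rw [Commute, SemiconjBy, numberOp, Finset.mul_sum, Finset.sum_mul]
  simp only [hac.ann_mul_cre_mul_ann, Finset.sum_add_distrib, Finset.sum_ite_eq, if_neg hi,
    add_zero]

theorem numberOp_mem_stabilizer (hac : IsOscillatorSystem F w a c) (s : Finset κ) (M : ℤ) :
    numberOp a c s ∈ stabilizer (F M) := by
  refine sum_mem fun i _ v hv => ?_
  simpa using mul_mem_degSub (hac.cre_mem i) (hac.ann_mem i) M v hv

theorem ann_apply_mem (hac : IsOscillatorSystem F w a c) (hF : IsTruncFiltration F) {M : ℤ} {v : V}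
    (hv : v ∈ F (M + 1)) (i : κ) : a i v ∈ F M :=
  hF.mono (by have := hac.weight_pos i; omega) (hac.ann_mem i _ _ hv)

theorem aeval_numberOp_descPochhammer_apply (hac : IsOscillatorSystem F w a c)
    (hF : IsTruncFiltration F) (s : Finset κ) {M : ℕ} {v : V} (hv : v ∈ F M) :
    Polynomial.aeval (numberOp a c s) (descPochhammer K M) v = 0 := by
  induction M generalizing v with
  | zero => rw [hF.eq_zero le_rfl hv, map_zero]
  | succ M ih =>
    rw [aeval_numberOp_descPochhammer_succ, Module.End.mul_apply, numberOp, LinearMap.sum_apply]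
    refine Finset.sum_eq_zero fun i hi => ?_
    rw [← numberOp, Module.End.mul_apply, ← Module.End.mul_apply (a i),
      (semiconjBy_aeval (hac.semiconjBy_ann hi) _).eq, Module.End.mul_apply,
      ih (hac.ann_apply_mem hF (by exact_mod_cast hv) i), map_zero]

theorem aeval_descPochhammer_mem_commonKernel (hac : IsOscillatorSystem F w a c)
    (hF : IsTruncFiltration F) {s : Finset κ} {M : ℕ} (hs : ∀ i, w i ≤ M → i ∈ s) {v : V}
    (hv : v ∈ F (M + 1)) :
    Polynomial.aeval (numberOp a c s - 1) (descPochhammer K M) v ∈ commonKernel a := by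
  refine mem_commonKernel.mpr fun i => ?_
  rw [← Module.End.mul_apply]
  by_cases hi : i ∈ s
  · rw [(semiconjBy_aeval (hac.semiconjBy_ann hi) _).eq, Module.End.mul_apply,
      hac.aeval_numberOp_descPochhammer_apply hF s (hac.ann_apply_mem hF hv i)]
  · have hiv : a i v = 0 := hF.eq_zero (by have := mt (hs i) hi; omega) (hac.ann_mem i _ _ hv)
    rw [(semiconjBy_aeval ((hac.commute_ann hi).sub_right (Commute.one_right _)) _).eq,
      Module.End.mul_apply, hiv, map_zero]

theorem numberOp_apply_mem (hac : IsOscillatorSystem F w a c) (hF : IsTruncFiltration F)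
    (s : Finset κ) {S : Submodule K V} (hSc : ∀ i, c i ∈ stabilizer S) {M : ℤ} (hFS : F M ≤ S)
    {v : V} (hv : v ∈ F (M + 1)) : numberOp a c s v ∈ S := by
  rw [numberOp, LinearMap.sum_apply]
  exact sum_mem fun i _ => hSc i _ (hFS (hac.ann_apply_mem hF hv i))

theorem aeval_sub_eval_smul_mem (hac : IsOscillatorSystem F w a c) (hF : IsTruncFiltration F)
    (s : Finset κ) {S : Submodule K V} (hSc : ∀ i, c i ∈ stabilizer S) {M : ℤ} (hFS : F M ≤ S)
    (p : Polynomial K) {v : V} (hv : v ∈ F (M + 1)) :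
    Polynomial.aeval (numberOp a c s - 1) p v - p.eval (-1) • v ∈ S := by
  obtain ⟨g, hg⟩ := Polynomial.X_sub_C_dvd_sub_C_eval (a := -1) (p := p)
  have hgv : Polynomial.aeval (numberOp a c s - 1) g v ∈ F (M + 1) :=
    Algebra.adjoin_le (Set.singleton_subset_iff.mpr
      (sub_mem (hac.numberOp_mem_stabilizer s _) (one_mem _)))
      (Polynomial.aeval_mem_adjoin_singleton _ _) v hv
  have hfactor := congrArg (fun f => Polynomial.aeval (numberOp a c s - 1) f v) hg
  simp only [map_sub, map_add, map_mul, Polynomial.aeval_X, Polynomial.aeval_C, LinearMap.sub_apply,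
    Module.algebraMap_end_apply, map_neg, map_one, sub_neg_eq_add, sub_add_cancel,
    Module.End.mul_apply] at hfactor
  rw [hfactor]
  exact hac.numberOp_apply_mem hF s hSc hFS hgv

theorem eventually_aeval_descPochhammer_apply_eq_zero (hac : IsOscillatorSystem F w a c)
    (hF : IsTruncFiltration F) {u : V} (hu : u ∈ creationRange c) :
    ∀ᶠ sM : Finset κ × ℕ in Filter.atTop,
      Polynomial.aeval (numberOp a c sM.1 - 1) (descPochhammer K sM.2) u = 0 := by
  induction hu using Submodule.iSup_induction' with
  | mem i u hu =>
    obtain ⟨v, rfl⟩ := hu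
    obtain ⟨M₀, hM₀⟩ := hF.exhaust v
    filter_upwards [Filter.eventually_ge_atTop ({i}, M₀)] with ⟨s, M⟩ ⟨hs, hM⟩
    have hi : i ∈ s := Finset.singleton_subset_iff.mp hs
    rw [← Module.End.mul_apply, ← (semiconjBy_aeval (hac.semiconjBy_cre hi) _).eq,
      Module.End.mul_apply, hac.aeval_numberOp_descPochhammer_apply hF s
        (hF.mono (by exact_mod_cast hM) hM₀), map_zero]
  | zero => simp
  | add u v _ _ hu hv =>
    filter_upwards [hu, hv] with sM hu hv
    rw [map_add, hu, hv, add_zero]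

variable [CharZero K]

theorem eval_neg_one_descPochhammer_ne_zero (M : ℕ) : (descPochhammer K M).eval (-1) ≠ 0 := by
  rw [descPochhammer_eval_eq_prod_range]
  refine Finset.prod_ne_zero_iff.mpr fun j _ => ?_
  rw [← neg_add', neg_ne_zero, add_comm]
  exact Nat.cast_add_one_ne_zero j

/-- On vectors of filtration index at most `M + 1`, the operator `∏_{j = 1}^M (N - j)` for the
number operator `N` projects to the common kernel, up to a nonzero factor and up to the range of
the creation operators. -/
theorem eq_top_of_commonKernel_le (hac : IsOscillatorSystem F w a c) (hF : IsTruncFiltration F)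
    {S : Submodule K V} (hS : commonKernel a ≤ S) (hSc : ∀ i, c i ∈ stabilizer S) : S = ⊤ := by
  suffices main : ∀ M : ℕ, F M ≤ S from eq_top_iff.mpr fun v _ =>
    let ⟨M, hM⟩ := hF.exhaust v
    main M hM
  intro M
  induction M with
  | zero => exact (hF.eq_bot 0 le_rfl).trans_le bot_le
  | succ M ih =>
    intro v hv
    rw [Nat.cast_succ] at hv
    have hvac := hS (hac.aeval_descPochhammer_mem_commonKernel hF
      (s := (hac.finite_weight_le M).toFinset) (fun i hi => by simpa using hi) hv)
    have hmod := hac.aeval_sub_eval_smul_mem hF (hac.finite_weight_le M).toFinset hSc ih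
      (descPochhammer K M) hv
    rwa [Submodule.sub_mem_iff_right _ hvac,
      Submodule.smul_mem_iff _ (eval_neg_one_descPochhammer_ne_zero M)] at hmod

theorem commonKernel_inf_creationRange (hac : IsOscillatorSystem F w a c)
    (hF : IsTruncFiltration F) : commonKernel a ⊓ creationRange c = ⊥ := by
  refine eq_bot_iff.mpr fun u ⟨hu, huc⟩ => ?_
  obtain ⟨⟨s, M⟩, hsM⟩ := (hac.eventually_aeval_descPochhammer_apply_eq_zero hF huc).exists
  have hnum : (numberOp a c s - 1) u = (-1 : K) • u := by
    simp [numberOp, mem_commonKernel.mp hu]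
  rw [Module.End.aeval_apply_of_mem_apply_eq_smul hnum] at hsM
  exact (smul_eq_zero_iff_right (eval_neg_one_descPochhammer_ne_zero M)).mp hsM

end IsOscillatorSystem

end Oscillators

/-! ### Heisenberg systems -/

section Heisenberg

variable {K V ι : Type*} [Field K] [AddCommGroup V] [Module K V] [Fintype ι] [DecidableEq ι]

/-- Operators `a (i, n)` of degree `n` and `b (i, n)` of degree `-n` that satisfy the Heisenberg
relations `[a_{i,m}, b_{j,n}] = δ_{mn} (β n)_{ij}` for invertible matrices `β n`. -/
structure IsHeisenbergSystem (F : ℤ → Submodule K V) (β : ℕ+ → Matrix ι ι K)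
    (a b : ι × ℕ+ → Module.End K V) : Prop where
  isUnit_det : ∀ n, IsUnit (β n).det
  ann_mem : ∀ i, a i ∈ degSub F i.2
  cre_mem : ∀ i, b i ∈ degSub F (-i.2)
  ann_comm : ∀ i j, Commute (a i) (a j)
  cre_comm : ∀ i j, Commute (b i) (b j)
  ann_cre : ∀ i j, a i * b j - b j * a i = if i.2 = j.2 then β i.2 i.1 j.1 • 1 else 0

/-- The combinations of the annihilation operators that are dual to the creation operators with
respect to the forms `β n`. -/
def dualAnn (β : ℕ+ → Matrix ι ι K) (a : ι × ℕ+ → Module.End K V) (i : ι × ℕ+) : Module.End K V :=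
  ∑ j, (β i.2)⁻¹ i.1 j • a (j, i.2)

namespace IsHeisenbergSystem

variable {F : ℤ → Submodule K V} {β : ℕ+ → Matrix ι ι K} {a b : ι × ℕ+ → Module.End K V}

theorem dualAnn_cre (hab : IsHeisenbergSystem F β a b) (i j : ι × ℕ+) :
    dualAnn β a i * b j - b j * dualAnn β a i = if i = j then 1 else 0 := by
  obtain ⟨i, m⟩ := i
  obtain ⟨j, n⟩ := j
  simp only [dualAnn, Finset.sum_mul, Finset.mul_sum, smul_mul_assoc, mul_smul_comm,
    ← Finset.sum_sub_distrib, ← smul_sub, hab.ann_cre]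
  obtain rfl | hmn := eq_or_ne m n
  · have hinv := congrFun₂ (Matrix.nonsing_inv_mul _ (hab.isUnit_det m)) i j
    rw [Matrix.mul_apply, Matrix.one_apply] at hinv
    simp only [if_true, smul_smul, ← Finset.sum_smul, hinv, Prod.mk.injEq, and_true, ite_smul,
      one_smul, zero_smul]
  · simp only [smul_zero, Finset.sum_const_zero, Prod.mk.injEq, hmn, and_false,
      if_false]

theorem isOscillatorSystem (hab : IsHeisenbergSystem F β a b) :
    IsOscillatorSystem F (fun i => i.2) (dualAnn β a) b where
  weight_pos i := i.2.pos
  finite_weight_le M := ((Set.finite_univ.prod ((Set.finite_Iic M).preimage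
    PNat.coe_injective.injOn))).subset fun _ hi => ⟨trivial, hi⟩
  ann_mem i := sum_mem fun j _ => Submodule.smul_mem _ _ (hab.ann_mem (j, i.2))
  cre_mem := hab.cre_mem
  ann_comm _ _ := Commute.sum_left _ _ _ fun _ _ => Commute.sum_right _ _ _ fun _ _ =>
    ((hab.ann_comm _ _).smul_left _).smul_right _
  cre_comm := hab.cre_comm
  ann_cre := hab.dualAnn_cre

theorem commonKernel_dualAnn (hab : IsHeisenbergSystem F β a b) :
    commonKernel (dualAnn β a) = commonKernel a := by
  ext v
  simp only [mem_commonKernel]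
  refine ⟨fun hv ⟨i, n⟩ => ?_, fun hv i => by simp [dualAnn, hv]⟩
  have hmul : (β n * (β n)⁻¹) = 1 := Matrix.mul_nonsing_inv _ (hab.isUnit_det n)
  have hsum : ∑ j, β n i j • dualAnn β a (j, n) = a (i, n) := by
    simp only [dualAnn, Finset.smul_sum, smul_smul]
    rw [Finset.sum_comm]
    simp only [← Finset.sum_smul, ← Matrix.mul_apply, hmul, Matrix.one_apply, ite_smul, one_smul,
      zero_smul, Finset.sum_ite_eq, Finset.mem_univ, if_true]
  simp [← hsum, hv]

end IsHeisenbergSystem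

end Heisenberg

/-! ### Nondegeneracy of the quantum Cartan matrices -/

section QuantumCartan

variable {K : Type*} [Field K]

/-- `P x - P (-x)`, that is, `q^x - q^{-x}` when `P x = q^x`. -/
def oddPart (P : AddChar ℚ K) (x : ℚ) : K := P x - P (-x)

/-- `P x + P (-x)`, that is, `q^x + q^{-x}` when `P x = q^x`. -/
def evenPart (P : AddChar ℚ K) (x : ℚ) : K := P x + P (-x)

/-- The quantum integer `[a]_{q_i}`, where `q_i = P d`. -/
def quantumInt (P : AddChar ℚ K) (d : ℚ) (a : ℤ) : K := oddPart P (d * a) / oddPart P d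

/-- The quantum Cartan matrix `([A_{ij}]_{q_i})`. -/
def quantumCartan (P : AddChar ℚ K) (T : DynkinType) : Matrix (Fin T.rank) (Fin T.rank) K :=
  .of fun i j => quantumInt P (T.halfSq i) (T.cartan i j)

variable {P : AddChar ℚ K}

@[simp] theorem oddPart_zero : oddPart P 0 = 0 := by simp [oddPart]

theorem oddPart_neg (x : ℚ) : oddPart P (-x) = -oddPart P x := by simp [oddPart]

theorem evenPart_neg (x : ℚ) : evenPart P (-x) = evenPart P x := by
  rw [evenPart, evenPart, neg_neg, add_comm]

theorem evenPart_mul_oddPart (x y : ℚ) :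
    evenPart P x * oddPart P y = oddPart P (y + x) + oddPart P (y - x) := by
  simp only [evenPart, oddPart, sub_eq_add_neg, neg_add, neg_neg, P.map_add_eq_mul]
  ring

theorem evenPart_mul_evenPart (x y : ℚ) :
    evenPart P x * evenPart P y = evenPart P (x + y) + evenPart P (x - y) := by
  simp only [evenPart, sub_eq_add_neg, neg_add, neg_neg, P.map_add_eq_mul]
  ring

theorem oddPart_two_mul (x : ℚ) : oddPart P (2 * x) = evenPart P x * oddPart P x := by
  rw [evenPart_mul_oddPart, sub_self, oddPart_zero, add_zero, two_mul]

theorem evenPart_two_mul (x : ℚ) : evenPart P (2 * x) = evenPart P x ^ 2 - 2 := by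
  rw [sq, evenPart_mul_evenPart, sub_self, ← two_mul, evenPart, evenPart, neg_zero,
    P.map_zero_eq_one]
  ring

theorem oddPart_three_mul (x : ℚ) :
    oddPart P (3 * x) = (evenPart P x ^ 2 - 1) * oddPart P x := by
  have h := evenPart_mul_oddPart (P := P) (2 * x) x
  rw [evenPart_two_mul, show x + 2 * x = 3 * x by ring, show x - 2 * x = -x by ring,
    oddPart_neg] at h
  linear_combination -h

theorem evenPart_three_mul (x : ℚ) :
    evenPart P (3 * x) = evenPart P x ^ 3 - 3 * evenPart P x := by
  have h := evenPart_mul_evenPart (P := P) (2 * x) x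
  rw [evenPart_two_mul, show 2 * x + x = 3 * x by ring, show 2 * x - x = x by ring] at h
  linear_combination -h

theorem evenPart_five_mul (x : ℚ) :
    evenPart P (5 * x) = evenPart P x ^ 5 - 5 * evenPart P x ^ 3 + 5 * evenPart P x := by
  have h := evenPart_mul_evenPart (P := P) (3 * x) (2 * x)
  rw [evenPart_two_mul, evenPart_three_mul, show 3 * x + 2 * x = 5 * x by ring,
    show 3 * x - 2 * x = x by ring] at h
  linear_combination -h

section Injective

variable (hP : Function.Injective P) {x : ℚ} (hx : x ≠ 0)
include hP hx

theorem oddPart_ne_zero : oddPart P x ≠ 0 :=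
  fun h => hx (self_eq_neg.mp (hP (sub_eq_zero.mp h)))

theorem evenPart_ne_zero : evenPart P x ≠ 0 := by
  refine left_ne_zero_of_mul (b := oddPart P x) ?_
  rw [← oddPart_two_mul]
  exact oddPart_ne_zero hP (mul_ne_zero two_ne_zero hx)

theorem evenPart_sub_one_ne_zero : evenPart P x - 1 ≠ 0 := by
  have hhalf : evenPart P (x / 2) * (evenPart P x - 1) = evenPart P (3 * (x / 2)) := by
    rw [mul_sub, mul_one, evenPart_mul_evenPart, show x / 2 - x = -(x / 2) by ring, evenPart_neg,
      add_sub_cancel_right, show x / 2 + x = 3 * (x / 2) by ring]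
  refine right_ne_zero_of_mul (a := evenPart P (x / 2)) ?_
  rw [hhalf]
  exact evenPart_ne_zero hP (mul_ne_zero three_ne_zero (div_ne_zero hx two_ne_zero))

theorem evenPart_sq_sub_one_ne_zero : evenPart P x ^ 2 - 1 ≠ 0 := by
  refine left_ne_zero_of_mul (b := oddPart P x) ?_
  rw [← oddPart_three_mul]
  exact oddPart_ne_zero hP (mul_ne_zero three_ne_zero hx)

theorem quantumInt_two : quantumInt P x 2 = evenPart P x := by
  rw [quantumInt, Int.cast_ofNat, mul_comm, oddPart_two_mul,
    mul_div_cancel_right₀ _ (oddPart_ne_zero hP hx)]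

theorem quantumInt_neg_one : quantumInt P x (-1) = -1 := by
  rw [quantumInt, Int.cast_neg, Int.cast_one, mul_neg_one, oddPart_neg, neg_div,
    div_self (oddPart_ne_zero hP hx)]

theorem quantumInt_neg_two : quantumInt P x (-2) = -evenPart P x := by
  rw [← quantumInt_two hP hx, quantumInt, quantumInt, Int.cast_neg, mul_neg, oddPart_neg, neg_div]

theorem quantumInt_neg_three : quantumInt P x (-3) = -(evenPart P x ^ 2 - 1) := by
  rw [quantumInt, Int.cast_neg, Int.cast_ofNat, mul_neg, oddPart_neg, mul_comm, oddPart_three_mul,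
    neg_div, mul_div_cancel_right₀ _ (oddPart_ne_zero hP hx)]

end Injective

@[simp] theorem quantumInt_zero (d : ℚ) : quantumInt P d 0 = 0 := by simp [quantumInt]

/-- A vector indexed by the `l` nodes of a diagram as a sequence whose entries `1, …, l` are the
given ones and whose other entries vanish, so that the ends of a diagram need no special rows. -/
def extendVec {l : ℕ} (c : Fin l → K) : ℕ → K := Function.extend (fun j : Fin l => (j : ℕ) + 1) c 0

section ExtendVec

variable {l : ℕ} (c : Fin l → K)

theorem extendVec_succ (j : Fin l) : extendVec c (j + 1) = c j :=
  Function.Injective.extend_apply (fun _ _ h => Fin.ext (Nat.succ_injective h)) c 0 j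

theorem extendVec_of_forall_ne {m : ℕ} (hm : ∀ j : Fin l, (j : ℕ) + 1 ≠ m) : extendVec c m = 0 :=
  Function.extend_apply' _ _ _ fun ⟨j, hj⟩ => hm j hj

theorem extendVec_zero : extendVec c 0 = 0 := extendVec_of_forall_ne c fun _ => Nat.succ_ne_zero _

theorem extendVec_end : extendVec c (l + 1) = 0 := extendVec_of_forall_ne c fun j => by lia

theorem eq_zero_of_extendVec {c : Fin l → K} (h : ∀ j < l, extendVec c (j + 1) = 0) : c = 0 :=
  funext fun j => (extendVec_succ c j).symm.trans (h j j.isLt)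

theorem sum_mul_eq_sum_extendVec {g : Fin l → K} (t : Finset ℕ) (G : ℕ → K)
    (hg : ∀ j : Fin l, g j = if (j : ℕ) + 1 ∈ t then G (j + 1) else 0) :
    ∑ j, g j * c j = ∑ m ∈ t, G m * extendVec c m := by
  have hterm (j : Fin l) : g j * c j =
      ∑ m ∈ t, if (j : ℕ) + 1 = m then G m * extendVec c m else 0 := by
    rw [Finset.sum_ite_eq, hg, ite_mul, zero_mul, extendVec_succ]
  simp_rw [hterm]
  rw [Finset.sum_comm]
  refine Finset.sum_congr rfl fun m _ => ?_
  by_cases hm : ∃ j : Fin l, (j : ℕ) + 1 = m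
  · obtain ⟨j, rfl⟩ := hm
    simp [Fin.val_inj]
  · push Not at hm
    simp [hm, extendVec_of_forall_ne c hm]

theorem sum_mul_eq_of_tridiagonal {g : Fin l → K} (i : Fin l) (a b b' : K)
    (hg : ∀ j, g j = if j = i then a else if (j : ℕ) + 1 = i then b
      else if (j : ℕ) = i + 1 then b' else 0) :
    ∑ j, g j * c j = a * extendVec c (i + 1) + b * extendVec c i + b' * extendVec c (i + 2) := by
  rw [sum_mul_eq_sum_extendVec c {(i : ℕ) + 1, (i : ℕ), (i : ℕ) + 2}
    (fun m => if m = i + 1 then a else if m = i then b else b')]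
  · simp [add_assoc]
  · grind

end ExtendVec

theorem chain_eq {d : ℚ} {y : ℕ → K} {L : ℕ} (hd : oddPart P d ≠ 0) (h0 : y 0 = 0)
    (hy : ∀ j, j + 2 ≤ L → evenPart P d * y (j + 1) = y j + y (j + 2)) :
    ∃ t, ∀ j ≤ L, y j = oddPart P (j * d) * t := by
  refine ⟨y 1 / oddPart P d, fun j => ?_⟩
  induction j using Nat.twoStepInduction with
  | zero => simp [h0]
  | one => intro _; field_simp; simp
  | more j ih₀ ih₁ =>
    intro hj
    have hs := evenPart_mul_oddPart (P := P) d (↑(j + 1) * d)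
    rw [show ((j + 1 : ℕ) : ℚ) * d + d = ↑(j + 2) * d by push_cast; ring,
      show ((j + 1 : ℕ) : ℚ) * d - d = j * d by push_cast; ring] at hs
    linear_combination (y 1 / oddPart P d) * hs - hy j hj + evenPart P d * ih₁ (by lia)
      - ih₀ (by lia)

section Injective

variable (hP : Function.Injective P)
include hP

theorem eq_zero_of_quantumCartan_A {l : ℕ} {hl : 1 ≤ l} {c : Fin l → K}
    (hc : (quantumCartan P (.A l hl)).mulVec c = 0) : c = 0 := by
  have row (i : Fin l) :
      evenPart P 1 * extendVec c (i + 1) = extendVec c i + extendVec c (i + 2) := by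
    have hi : ∑ j, quantumInt P 1 (CartanMatrix.A l j i) * c j = 0 := congrFun hc i
    rw [sum_mul_eq_of_tridiagonal c i (evenPart P 1) (-1) (-1)] at hi
    · linear_combination hi
    · intro j
      simp only [CartanMatrix.A, Matrix.of_apply, apply_ite (quantumInt P 1),
        quantumInt_two hP one_ne_zero, quantumInt_neg_one hP one_ne_zero, quantumInt_zero]
      grind
  obtain ⟨t, ht⟩ := chain_eq (oddPart_ne_zero hP one_ne_zero) (extendVec_zero c) (L := l + 1)
    fun j hj => row ⟨j, by lia⟩
  have h0 : oddPart P ((l + 1 : ℕ) * 1) * t = 0 := by rw [← ht _ le_rfl, extendVec_end]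
  obtain rfl := (mul_eq_zero.mp h0).resolve_left (oddPart_ne_zero hP (by positivity))
  exact eq_zero_of_extendVec fun j hj => by rw [ht _ (by lia), mul_zero]

theorem eq_zero_of_chain_B {n : ℕ} {y : ℕ → K} (h0 : y 0 = 0)
    (row : ∀ j, j < n → evenPart P 1 * y (j + 1) = y j + y (j + 2))
    (last : y (n + 1) = y n) : ∀ j ≤ n + 1, y j = 0 := by
  have hhalf : (1 / 2 : ℚ) ≠ 0 := by norm_num
  obtain ⟨t, ht⟩ := chain_eq (oddPart_ne_zero hP one_ne_zero) h0 (L := n + 1)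
    fun j hj => row j (by lia)
  have hmul : evenPart P (n + 1 / 2) * oddPart P (1 / 2) * t = 0 := by
    rw [ht _ le_rfl, ht _ n.le_succ] at last
    rw [evenPart_mul_oddPart, show (1 / 2 : ℚ) + (n + 1 / 2) = (n + 1 : ℕ) * 1 by push_cast; ring,
      show (1 / 2 : ℚ) - (n + 1 / 2) = -(n * 1) by ring, oddPart_neg]
    linear_combination last
  obtain rfl := (mul_eq_zero.mp hmul).resolve_left
    (mul_ne_zero (evenPart_ne_zero hP (by positivity)) (oddPart_ne_zero hP hhalf))
  exact fun j hj => by rw [ht _ hj, mul_zero]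

theorem eq_zero_of_quantumCartan_B {l : ℕ} {hl : 3 ≤ l} {c : Fin l → K}
    (hc : (quantumCartan P (.B l hl)).mulVec c = 0) : c = 0 := by
  have hhalf : (1 / 2 : ℚ) ≠ 0 := by norm_num
  obtain ⟨n, rfl⟩ := Nat.exists_eq_add_of_le' (le_of_add_le_right hl : 1 ≤ l)
  have hrow (i : Fin (n + 1)) : ∑ j, quantumInt P (if (i : ℕ) + 1 = n + 1 then 1 / 2 else 1)
    (CartanMatrix.B (n + 1) j i) * c j = 0 := congrFun hc i
  refine eq_zero_of_extendVec fun j hj =>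
    eq_zero_of_chain_B hP (extendVec_zero c) (fun i hi => ?_) ?_ (j + 1) hj
  · have hi' := hrow ⟨i, by lia⟩
    rw [if_neg (by lia), sum_mul_eq_of_tridiagonal c ⟨i, by lia⟩ (evenPart P 1) (-1) (-1)] at hi'
    · linear_combination hi'
    · intro j
      simp only [CartanMatrix.B, Matrix.of_apply, apply_ite (quantumInt P 1),
        quantumInt_two hP one_ne_zero, quantumInt_neg_one hP one_ne_zero, quantumInt_zero]
      grind
  · have hi := hrow ⟨n, by lia⟩
    rw [if_pos rfl, sum_mul_eq_of_tridiagonal c ⟨n, by lia⟩ (evenPart P (1 / 2))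
      (-evenPart P (1 / 2)) 0] at hi
    · refine mul_left_cancel₀ (evenPart_ne_zero hP hhalf) ?_
      linear_combination hi
    · intro j
      simp only [CartanMatrix.B, Matrix.of_apply, apply_ite (quantumInt P (1 / 2)),
        quantumInt_two hP hhalf, quantumInt_neg_one hP hhalf, quantumInt_neg_two hP hhalf,
        quantumInt_zero]
      grind

theorem eq_zero_of_chain_C {n : ℕ} {y : ℕ → K} (h0 : y 0 = 0)
    (row : ∀ j, j < n → evenPart P (1 / 2) * y (j + 1) = y j + y (j + 2))
    (row' : evenPart P (1 / 2) * y (n + 1) = y n + evenPart P (1 / 2) * y (n + 2))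
    (last : evenPart P 1 * y (n + 2) = y (n + 1)) : ∀ j ≤ n + 2, y j = 0 := by
  have hhalf : (1 / 2 : ℚ) ≠ 0 := by norm_num
  obtain ⟨t, ht⟩ := chain_eq (oddPart_ne_zero hP hhalf) h0 (L := n + 1)
    fun j hj => row j (by lia)
  have hmul : evenPart P ((n + 3) / 2) * oddPart P (1 / 2) * t = 0 := by
    have e₁ := evenPart_mul_oddPart (P := P) (1 / 2) ((n + 1 : ℕ) * (1 / 2))
    have e₂ := evenPart_mul_oddPart (P := P) 1 ((n + 2) / 2)
    have e₃ := evenPart_mul_oddPart (P := P) ((n + 3) / 2) (1 / 2)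
    rw [show (n + 1 : ℕ) * (1 / 2) + 1 / 2 = ((n : ℚ) + 2) / 2 by push_cast; ring,
      show (n + 1 : ℕ) * (1 / 2) - 1 / 2 = (n : ℚ) * (1 / 2) by push_cast; ring] at e₁
    rw [show ((n : ℚ) + 2) / 2 - 1 = n * (1 / 2) by ring] at e₂
    rw [show (1 / 2 : ℚ) + (n + 3) / 2 = (n + 2) / 2 + 1 by ring,
      show 1 / 2 - ((n : ℚ) + 3) / 2 = -((n + 2) / 2) by ring, oddPart_neg] at e₃
    linear_combination t * e₃ - t * e₂ - (evenPart P 1 - 1) * t * e₁ + evenPart P 1 * row'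
      + evenPart P (1 / 2) * last + evenPart P 1 * ht n (by lia)
      - (evenPart P 1 - 1) * evenPart P (1 / 2) * ht (n + 1) le_rfl
  obtain rfl := (mul_eq_zero.mp hmul).resolve_left
    (mul_ne_zero (evenPart_ne_zero hP (by positivity)) (oddPart_ne_zero hP hhalf))
  have hn : y (n + 1) = 0 := by rw [ht _ le_rfl, mul_zero]
  intro j hj
  obtain hj | rfl := Nat.le_succ_iff.mp hj
  · rw [ht _ hj, mul_zero]
  · exact (mul_eq_zero.mp (last.trans hn)).resolve_left (evenPart_ne_zero hP one_ne_zero)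

theorem eq_zero_of_quantumCartan_C {l : ℕ} {hl : 2 ≤ l} {c : Fin l → K}
    (hc : (quantumCartan P (.C l hl)).mulVec c = 0) : c = 0 := by
  have hhalf : (1 / 2 : ℚ) ≠ 0 := by norm_num
  obtain ⟨n, rfl⟩ := Nat.exists_eq_add_of_le' hl
  have hrow (i : Fin (n + 2)) : ∑ j, quantumInt P (if (i : ℕ) + 1 = n + 2 then 1 else 1 / 2)
    (CartanMatrix.C (n + 2) j i) * c j = 0 := congrFun hc i
  have row (i : ℕ) (hi : i < n + 1) :
      evenPart P (1 / 2) * extendVec c (i + 1) = extendVec c i +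
        (if i = n then evenPart P (1 / 2) else 1) * extendVec c (i + 2) := by
    have hi' := hrow ⟨i, by lia⟩
    rw [if_neg (by lia), sum_mul_eq_of_tridiagonal c ⟨i, by lia⟩ (evenPart P (1 / 2)) (-1)
      (-if i = n then evenPart P (1 / 2) else 1)] at hi'
    · linear_combination hi'
    · intro j
      simp only [CartanMatrix.C, Matrix.of_apply, apply_ite (quantumInt P (1 / 2)),
        quantumInt_two hP hhalf, quantumInt_neg_one hP hhalf, quantumInt_neg_two hP hhalf,
        quantumInt_zero]
      grind
  have last : evenPart P 1 * extendVec c (n + 2) = extendVec c (n + 1) := by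
    have hi := hrow ⟨n + 1, by lia⟩
    rw [if_pos rfl, sum_mul_eq_of_tridiagonal c ⟨n + 1, by lia⟩ (evenPart P 1) (-1) 0] at hi
    · linear_combination hi
    · intro j
      simp only [CartanMatrix.C, Matrix.of_apply, apply_ite (quantumInt P 1),
        quantumInt_two hP one_ne_zero, quantumInt_neg_one hP one_ne_zero, quantumInt_zero]
      grind
  refine eq_zero_of_extendVec fun j hj => eq_zero_of_chain_C hP (extendVec_zero c)
    (fun i hi => ?_) ?_ last (j + 1) hj
  · simpa only [hi.ne, if_false, one_mul] using row i (by lia)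
  · simpa only [if_true] using row n (by lia)

theorem eq_zero_of_chain_D {n : ℕ} {y : ℕ → K} (h0 : y 0 = 0)
    (row : ∀ j, j ≤ n → evenPart P 1 * y (j + 1) = y j + y (j + 2))
    (branch : evenPart P 1 * y (n + 2) = y (n + 1) + y (n + 3) + y (n + 4))
    (last : evenPart P 1 * y (n + 3) = y (n + 2)) (last' : evenPart P 1 * y (n + 4) = y (n + 2)) :
    ∀ j ≤ n + 4, y j = 0 := by
  obtain ⟨t, ht⟩ := chain_eq (oddPart_ne_zero hP one_ne_zero) h0 (L := n + 2)
    fun j hj => row j (by lia)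
  have hmul : evenPart P (n + 3) * oddPart P 1 * t = 0 := by
    have e₁ := evenPart_mul_oddPart (P := P) 1 ((n + 1 : ℕ) * 1)
    have e₂ := evenPart_mul_oddPart (P := P) (2 * 1) ((n + 2 : ℕ) * 1)
    have e₃ := evenPart_mul_oddPart (P := P) (n + 3) 1
    rw [show (n + 1 : ℕ) * 1 + 1 = ((n + 2 : ℕ) * 1 : ℚ) by push_cast; ring,
      show (n + 1 : ℕ) * 1 - 1 = (n : ℚ) by push_cast; ring] at e₁
    rw [show (n + 2 : ℕ) * 1 - 2 * 1 = (n : ℚ) by push_cast; ring, evenPart_two_mul] at e₂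
    rw [show 1 + ((n : ℚ) + 3) = (n + 2 : ℕ) * 1 + 2 * 1 by push_cast; ring,
      show 1 - ((n : ℚ) + 3) = -((n + 2 : ℕ) * 1) by push_cast; ring, oddPart_neg] at e₃
    linear_combination t * e₃ - t * e₂ + t * e₁ + evenPart P 1 * branch + last + last'
      - (evenPart P 1 ^ 2 - 2) * ht (n + 2) le_rfl + evenPart P 1 * ht (n + 1) (by lia)
  obtain rfl := (mul_eq_zero.mp hmul).resolve_left
    (mul_ne_zero (evenPart_ne_zero hP (by positivity)) (oddPart_ne_zero hP one_ne_zero))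
  have hn : y (n + 2) = 0 := by rw [ht _ le_rfl, mul_zero]
  have hne : evenPart P 1 ≠ 0 := evenPart_ne_zero hP one_ne_zero
  intro j hj
  obtain hj | rfl | rfl : j ≤ n + 2 ∨ j = n + 3 ∨ j = n + 4 := by lia
  · rw [ht _ hj, mul_zero]
  · exact (mul_eq_zero.mp (last.trans hn)).resolve_left hne
  · exact (mul_eq_zero.mp (last'.trans hn)).resolve_left hne

theorem eq_zero_of_quantumCartan_D {l : ℕ} {hl : 4 ≤ l} {c : Fin l → K}
    (hc : (quantumCartan P (.D l hl)).mulVec c = 0) : c = 0 := by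
  obtain ⟨n, rfl⟩ := Nat.exists_eq_add_of_le' hl
  have hrow (i : Fin (n + 4)) :
    ∑ j, quantumInt P 1 (CartanMatrix.D (n + 4) j i) * c j = 0 := congrFun hc i
  have entry (i j : Fin (n + 4)) : quantumInt P 1 (CartanMatrix.D (n + 4) j i) =
      if j = i then evenPart P 1
      else if (j : ℕ) + 1 = i ∧ (i : ℕ) ≤ n + 2 ∨ (i : ℕ) + 1 = j ∧ (j : ℕ) ≤ n + 2 ∨
        (j : ℕ) = n + 1 ∧ (i : ℕ) = n + 3 ∨ (i : ℕ) = n + 1 ∧ (j : ℕ) = n + 3 then -1 else 0 := by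
    simp only [CartanMatrix.D, Matrix.of_apply, apply_ite (quantumInt P 1),
      quantumInt_two hP one_ne_zero, quantumInt_neg_one hP one_ne_zero, quantumInt_zero]
    grind
  refine eq_zero_of_extendVec fun j hj =>
    eq_zero_of_chain_D hP (extendVec_zero c) (fun i hi => ?_) ?_ ?_ ?_ (j + 1) hj
  · have hi' := hrow ⟨i, by lia⟩
    rw [sum_mul_eq_of_tridiagonal c ⟨i, by lia⟩ (evenPart P 1) (-1) (-1) (by grind)] at hi'
    linear_combination hi'
  · have hi := hrow ⟨n + 1, by lia⟩
    rw [sum_mul_eq_sum_extendVec c {n + 1, n + 2, n + 3, n + 4}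
      (fun m => if m = n + 2 then evenPart P 1 else -1) (by grind)] at hi
    simp only [Finset.mem_insert, Finset.mem_singleton, Nat.add_left_cancel_iff,
      Finset.sum_insert, Finset.sum_singleton, Nat.reduceEqDiff, or_self, not_false_eq_true,
      if_true, if_false] at hi
    linear_combination hi
  · have hi := hrow ⟨n + 2, by lia⟩
    rw [sum_mul_eq_of_tridiagonal c ⟨n + 2, by lia⟩ (evenPart P 1) (-1) 0 (by grind)] at hi
    linear_combination hi
  · have hi := hrow ⟨n + 3, by lia⟩
    rw [sum_mul_eq_sum_extendVec c {n + 2, n + 4}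
      (fun m => if m = n + 2 then -1 else evenPart P 1) (by grind)] at hi
    rw [Finset.sum_pair (by lia), if_pos rfl, if_neg (by lia)] at hi
    linear_combination hi

end Injective

theorem branch_eq {τ c₀ c₁ c₂ b n : K} (r₀ : τ * c₀ = c₂) (r₁ : τ * c₁ = b)
    (r₂ : τ * c₂ = c₀ + b) (r₃ : τ * b = c₁ + c₂ + n) :
    (τ ^ 4 - 3 * τ ^ 2 + 1) * b = τ * (τ ^ 2 - 1) * n := by
  linear_combination τ * (τ ^ 2 - 1) * r₃ + (τ ^ 2 - 1) * r₁ + τ * r₀ + τ ^ 2 * r₂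

/-- The matrix `(q^{(α_i|α_j)} - q^{-(α_i|α_j)})`. -/
def oddForm (P : AddChar ℚ K) (T : DynkinType) : Matrix (Fin T.rank) (Fin T.rank) K :=
  .of fun i j => oddPart P (T.form i j)

theorem halfSq_ne_zero (T : DynkinType) (i : Fin T.rank) : T.halfSq i ≠ 0 := by
  cases T with
  | B l hl =>
    change (if (i : ℕ) + 1 = l then (1 / 2 : ℚ) else 1) ≠ 0
    split_ifs <;> norm_num
  | C l hl =>
    change (if (i : ℕ) + 1 = l then (1 : ℚ) else 1 / 2) ≠ 0
    split_ifs <;> norm_num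
  | F4 =>
    have h : ∀ j : Fin 4, (![1, 1, 1 / 2, 1 / 2] : Fin 4 → ℚ) j ≠ 0 := by
      simp [Fin.forall_fin_succ]
    exact h i
  | G2 =>
    have h : ∀ j : Fin 2, (![1, 1 / 3] : Fin 2 → ℚ) j ≠ 0 := by
      simp [Fin.forall_fin_succ]
    exact h i
  | _ => exact one_ne_zero

section Injective

variable (hP : Function.Injective P)
include hP

theorem arms_eq_zero {c₀ c₁ c₂ b : K} (r₀ : evenPart P 1 * c₀ = c₂) (r₁ : evenPart P 1 * c₁ = b)
    (r₂ : evenPart P 1 * c₂ = c₀ + b) (hb : b = 0) : c₀ = 0 ∧ c₁ = 0 ∧ c₂ = 0 := by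
  have h₀ : c₀ = 0 := by
    refine (mul_eq_zero.mp ?_).resolve_left (evenPart_sq_sub_one_ne_zero hP one_ne_zero)
    linear_combination evenPart P 1 * r₀ + r₂ + hb
  exact ⟨h₀, (mul_eq_zero.mp (r₁.trans hb)).resolve_left (evenPart_ne_zero hP one_ne_zero),
    by rw [← r₀, h₀, mul_zero]⟩

theorem eq_zero_of_quantumCartan_E6 {c : Fin 6 → K}
    (hc : (quantumCartan P .E6).mulVec c = 0) : c = 0 := by
  set τ := evenPart P 1
  obtain ⟨r₀, r₁, r₂, r₃, r₄, r₅⟩ : τ * c 0 = c 2 ∧ τ * c 1 = c 3 ∧ τ * c 2 = c 0 + c 3 ∧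
      τ * c 3 = c 1 + c 2 + c 4 ∧ τ * c 4 = c 3 + c 5 ∧ τ * c 5 = c 4 := by
    have row (i : Fin 6) : ∑ j, quantumInt P 1 (CartanMatrix.E₆ j i) * c j = 0 := congrFun hc i
    simp only [Fin.forall_fin_succ, Fin.sum_univ_six, CartanMatrix.E₆, Matrix.of_apply,
      Matrix.cons_val, Matrix.cons_val', Matrix.cons_val_zero, Matrix.cons_val_one,
      Matrix.cons_val_succ, quantumInt_two hP one_ne_zero, quantumInt_neg_one hP one_ne_zero,
      quantumInt_zero] at row
    grind
  have h₄ : c 4 = τ * c 5 := r₅.symm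
  have h₃ : c 3 = (τ ^ 2 - 1) * c 5 := by linear_combination τ * h₄ - r₄
  have h₅ : c 5 = 0 := by
    have hτ : evenPart P 4 = τ ^ 4 - 4 * τ ^ 2 + 2 := by
      rw [show (4 : ℚ) = 2 * (2 * 1) by norm_num, evenPart_two_mul, evenPart_two_mul]
      ring
    have h : (τ ^ 2 - 1) * (evenPart P 4 - 1) * c 5 = 0 := by
      have hb := branch_eq r₀ r₁ r₂ r₃
      rw [h₃, h₄] at hb
      linear_combination hb + (τ ^ 2 - 1) * c 5 * hτ
    exact (mul_eq_zero.mp h).resolve_left (mul_ne_zero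
      (evenPart_sq_sub_one_ne_zero hP one_ne_zero) (evenPart_sub_one_ne_zero hP four_ne_zero))
  rw [h₅, mul_zero] at h₃ h₄
  obtain ⟨h₀, h₁, h₂⟩ := arms_eq_zero hP r₀ r₁ r₂ h₃
  funext i
  fin_cases i
  exacts [h₀, h₁, h₂, h₃, h₄, h₅]

theorem eq_zero_of_quantumCartan_E7 {c : Fin 7 → K}
    (hc : (quantumCartan P .E7).mulVec c = 0) : c = 0 := by
  set τ := evenPart P 1
  obtain ⟨r₀, r₁, r₂, r₃, r₄, r₅, r₆⟩ : τ * c 0 = c 2 ∧ τ * c 1 = c 3 ∧ τ * c 2 = c 0 + c 3 ∧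
      τ * c 3 = c 1 + c 2 + c 4 ∧ τ * c 4 = c 3 + c 5 ∧ τ * c 5 = c 4 + c 6 ∧ τ * c 6 = c 5 := by
    have row (i : Fin 7) : ∑ j, quantumInt P 1 (CartanMatrix.E₇ j i) * c j = 0 := congrFun hc i
    simp only [Fin.forall_fin_succ, Fin.sum_univ_seven, CartanMatrix.E₇, Matrix.of_apply,
      Matrix.cons_val, Matrix.cons_val', Matrix.cons_val_zero, Matrix.cons_val_one,
      Matrix.cons_val_succ, quantumInt_two hP one_ne_zero, quantumInt_neg_one hP one_ne_zero,
      quantumInt_zero] at row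
    grind
  have h₅ : c 5 = τ * c 6 := r₆.symm
  have h₄ : c 4 = (τ ^ 2 - 1) * c 6 := by linear_combination τ * h₅ - r₅
  have h₃ : c 3 = (τ ^ 3 - 2 * τ) * c 6 := by linear_combination τ * h₄ - h₅ - r₄
  have h₆ : c 6 = 0 := by
    have hτ : evenPart P 6 = τ ^ 6 - 6 * τ ^ 4 + 9 * τ ^ 2 - 2 := by
      rw [show (6 : ℚ) = 2 * (3 * 1) by norm_num, evenPart_two_mul, evenPart_three_mul]
      ring
    have h : τ * (evenPart P 6 - 1) * c 6 = 0 := by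
      have hb := branch_eq r₀ r₁ r₂ r₃
      rw [h₃, h₄] at hb
      linear_combination hb + τ * c 6 * hτ
    exact (mul_eq_zero.mp h).resolve_left (mul_ne_zero
      (evenPart_ne_zero hP one_ne_zero) (evenPart_sub_one_ne_zero hP (by norm_num)))
  rw [h₆, mul_zero] at h₃ h₄ h₅
  obtain ⟨h₀, h₁, h₂⟩ := arms_eq_zero hP r₀ r₁ r₂ h₃
  funext i
  fin_cases i
  exacts [h₀, h₁, h₂, h₃, h₄, h₅, h₆]

theorem eq_zero_of_quantumCartan_E8 {c : Fin 8 → K}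
    (hc : (quantumCartan P .E8).mulVec c = 0) : c = 0 := by
  set τ := evenPart P 1
  obtain ⟨r₀, r₁, r₂, r₃, r₄, r₅, r₆, r₇⟩ : τ * c 0 = c 2 ∧ τ * c 1 = c 3 ∧
      τ * c 2 = c 0 + c 3 ∧ τ * c 3 = c 1 + c 2 + c 4 ∧ τ * c 4 = c 3 + c 5 ∧
      τ * c 5 = c 4 + c 6 ∧ τ * c 6 = c 5 + c 7 ∧ τ * c 7 = c 6 := by
    have row (i : Fin 8) : ∑ j, quantumInt P 1 (CartanMatrix.E₈ j i) * c j = 0 := congrFun hc i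
    simp only [Fin.forall_fin_succ, Fin.sum_univ_eight, CartanMatrix.E₈, Matrix.of_apply,
      Matrix.cons_val, Matrix.cons_val', Matrix.cons_val_zero, Matrix.cons_val_one,
      Matrix.cons_val_succ, quantumInt_two hP one_ne_zero, quantumInt_neg_one hP one_ne_zero,
      quantumInt_zero] at row
    grind
  have h₆ : c 6 = τ * c 7 := r₇.symm
  have h₅ : c 5 = (τ ^ 2 - 1) * c 7 := by linear_combination τ * h₆ - r₆
  have h₄ : c 4 = (τ ^ 3 - 2 * τ) * c 7 := by linear_combination τ * h₅ - h₆ - r₅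
  have h₃ : c 3 = (τ ^ 4 - 3 * τ ^ 2 + 1) * c 7 := by linear_combination τ * h₄ - h₅ - r₄
  have h₇ : c 7 = 0 := by
    have hτ : evenPart P 10 = (τ ^ 5 - 5 * τ ^ 3 + 5 * τ) ^ 2 - 2 := by
      rw [show (10 : ℚ) = 2 * (5 * 1) by norm_num, evenPart_two_mul, evenPart_five_mul]
    have h : (evenPart P 10 - 1) * c 7 = 0 := by
      have hb := branch_eq r₀ r₁ r₂ r₃
      rw [h₃, h₄] at hb
      linear_combination (τ ^ 2 - 3) * hb + c 7 * hτ
    exact (mul_eq_zero.mp h).resolve_left (evenPart_sub_one_ne_zero hP (by norm_num))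
  rw [h₇, mul_zero] at h₃ h₄ h₅ h₆
  obtain ⟨h₀, h₁, h₂⟩ := arms_eq_zero hP r₀ r₁ r₂ h₃
  funext i
  fin_cases i
  exacts [h₀, h₁, h₂, h₃, h₄, h₅, h₆, h₇]

theorem eq_zero_of_quantumCartan_F4 {c : Fin 4 → K}
    (hc : (quantumCartan P .F4).mulVec c = 0) : c = 0 := by
  have hhalf : (1 / 2 : ℚ) ≠ 0 := by norm_num
  have hτ : evenPart P 1 = evenPart P (1 / 2) ^ 2 - 2 := by
    rw [← evenPart_two_mul, mul_one_div_cancel two_ne_zero]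
  set τ := evenPart P 1
  set σ := evenPart P (1 / 2)
  obtain ⟨r₀, r₁, r₂, r₃⟩ : τ * c 0 = c 1 ∧ τ * c 1 = c 0 + c 2 ∧ σ * c 2 = σ * c 1 + c 3 ∧
      σ * c 3 = c 2 := by
    have row (i : Fin 4) :
      ∑ j, quantumInt P (![1, 1, 1 / 2, 1 / 2] i) (CartanMatrix.F₄ j i) * c j = 0 := congrFun hc i
    simp only [Fin.forall_fin_succ, Fin.sum_univ_four, CartanMatrix.F₄, Matrix.of_apply,
      Matrix.cons_val, Matrix.cons_val', Matrix.cons_val_zero, Matrix.cons_val_one,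
      Matrix.cons_val_succ, quantumInt_two hP one_ne_zero, quantumInt_neg_one hP one_ne_zero,
      quantumInt_two hP hhalf, quantumInt_neg_one hP hhalf, quantumInt_neg_two hP hhalf,
      quantumInt_zero] at row
    grind
  have h₁ : c 1 = τ * c 0 := r₀.symm
  have h₂ : c 2 = (τ ^ 2 - 1) * c 0 := by linear_combination τ * h₁ - r₁
  have h₀ : c 0 = 0 := by
    have hτ₃ : evenPart P 3 = τ ^ 3 - 3 * τ := by rw [← evenPart_three_mul, mul_one]
    have h : (evenPart P 3 - 1) * c 0 = 0 := by
      linear_combination c 0 * hτ₃ + σ * r₂ + r₃ - (σ ^ 2 - 1) * h₂ + σ ^ 2 * h₁ +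
        (τ ^ 2 - τ - 1) * c 0 * hτ
    exact (mul_eq_zero.mp h).resolve_left (evenPart_sub_one_ne_zero hP three_ne_zero)
  rw [h₀, mul_zero] at h₁ h₂
  have h₃ : c 3 = 0 := by linear_combination σ * h₂ - σ * h₁ - r₂
  funext i
  fin_cases i
  exacts [h₀, h₁, h₂, h₃]

theorem eq_zero_of_quantumCartan_G2 {c : Fin 2 → K}
    (hc : (quantumCartan P .G2).mulVec c = 0) : c = 0 := by
  have hthird : (1 / 3 : ℚ) ≠ 0 := by norm_num
  have hτ : evenPart P 1 = evenPart P (1 / 3) ^ 3 - 3 * evenPart P (1 / 3) := by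
    rw [← evenPart_three_mul, mul_one_div_cancel three_ne_zero]
  set τ := evenPart P 1
  set ρ := evenPart P (1 / 3)
  obtain ⟨r₀, r₁⟩ : τ * c 0 = c 1 ∧ ρ * c 1 = (ρ ^ 2 - 1) * c 0 := by
    have row (i : Fin 2) :
      ∑ j, quantumInt P (![1, 1 / 3] i) (CartanMatrix.G₂ j i) * c j = 0 := congrFun hc i
    simp only [Fin.forall_fin_succ, Fin.sum_univ_two, CartanMatrix.G₂, Matrix.of_apply,
      Matrix.cons_val', Matrix.cons_val_zero, Matrix.cons_val_one,
      Matrix.cons_val_succ, quantumInt_two hP one_ne_zero, quantumInt_neg_one hP one_ne_zero,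
      quantumInt_two hP hthird, quantumInt_neg_three hP hthird] at row
    grind
  have h₀ : c 0 = 0 := by
    have hρ : evenPart P (2 * (2 * (1 / 3))) = (ρ ^ 2 - 2) ^ 2 - 2 := by
      rw [evenPart_two_mul, evenPart_two_mul]
    have h : (evenPart P (2 * (2 * (1 / 3))) - 1) * c 0 = 0 := by
      linear_combination c 0 * hρ - ρ * c 0 * hτ + ρ * r₀ + r₁
    exact (mul_eq_zero.mp h).resolve_left (evenPart_sub_one_ne_zero hP (by norm_num))
  have h₁ : c 1 = 0 := by rw [← r₀, h₀, mul_zero]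
  funext i
  fin_cases i
  exacts [h₀, h₁]

theorem isUnit_det_quantumCartan (T : DynkinType) : IsUnit (quantumCartan P T).det := by
  rw [isUnit_iff_ne_zero, Ne, ← Matrix.exists_mulVec_eq_zero_iff]
  rintro ⟨c, hc₀, hc⟩
  refine hc₀ ?_
  cases T with
  | A => exact eq_zero_of_quantumCartan_A hP hc
  | B => exact eq_zero_of_quantumCartan_B hP hc
  | C => exact eq_zero_of_quantumCartan_C hP hc
  | D => exact eq_zero_of_quantumCartan_D hP hc
  | E6 => exact eq_zero_of_quantumCartan_E6 hP hc
  | E7 => exact eq_zero_of_quantumCartan_E7 hP hc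
  | E8 => exact eq_zero_of_quantumCartan_E8 hP hc
  | F4 => exact eq_zero_of_quantumCartan_F4 hP hc
  | G2 => exact eq_zero_of_quantumCartan_G2 hP hc

theorem isUnit_det_oddForm (T : DynkinType) : IsUnit (oddForm P T).det := by
  have hdiag : oddForm P T = .diagonal (fun i => oddPart P (T.halfSq i)) * quantumCartan P T := by
    ext i j
    have := oddPart_ne_zero hP (halfSq_ne_zero T i)
    simp only [oddForm, quantumCartan, quantumInt, DynkinType.form, Matrix.diagonal_mul,
      Matrix.of_apply]
    field_simp
  rw [hdiag, Matrix.det_mul, Matrix.det_diagonal]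
  exact (isUnit_iff_ne_zero.mpr (Finset.prod_ne_zero_iff.mpr fun i _ =>
    oddPart_ne_zero hP (halfSq_ne_zero T i))).mul (isUnit_det_quantumCartan hP T)

end Injective

end QuantumCartan

/-! ### Gradings by the eigenspaces of an operator -/

section Grading

variable {K V κ : Type*} [Field K] [AddCommGroup V] [Module K V] {D : Module.End K V}

/-- The filtration attached to an operator `D`: the sum of those eigenspaces whose eigenvalue `c`
satisfies `V_{c + n} = 0` for `n ≥ M`. -/
def eigenFiltration (D : Module.End K V) (M : ℤ) : Submodule K V :=
  ⨆ (c : K) (_ : ∀ n : ℤ, M ≤ n → D.eigenspace (c + n) = ⊥), D.eigenspace c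

theorem eigenFiltration_mono : Monotone (eigenFiltration D) := fun _ _ hM =>
  iSup_mono fun _ => iSup_le fun hc => le_iSup_of_le (fun n hn => hc n (hM.trans hn)) le_rfl

theorem eigenspace_le_eigenFiltration {c : K} {M : ℤ}
    (hc : ∀ n : ℤ, M ≤ n → D.eigenspace (c + n) = ⊥) : D.eigenspace c ≤ eigenFiltration D M :=
  le_iSup₂_of_le c hc le_rfl

theorem isTruncFiltration_eigenFiltration (hgr : (⨆ a : K, D.eigenspace a) = ⊤)
    (htr : ∀ a : K, ∃ n₀ : ℕ, ∀ n : ℕ, n₀ < n → D.eigenspace (a + n) = ⊥) :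
    IsTruncFiltration (eigenFiltration D) where
  mono := eigenFiltration_mono
  eq_bot M hM := eq_bot_iff.mpr (iSup₂_le fun c hc => by simpa using (hc 0 hM).le)
  exhaust v := by
    have hv : v ∈ ⨆ a : K, D.eigenspace a := hgr ▸ Submodule.mem_top
    induction hv using Submodule.iSup_induction' with
    | mem c x hx =>
      obtain ⟨n₀, hn₀⟩ := htr c
      refine ⟨n₀ + 1, eigenspace_le_eigenFiltration (fun n hn => ?_) hx⟩
      lift n to ℕ using by omega
      exact_mod_cast hn₀ n (by omega)
    | zero => exact ⟨0, zero_mem _⟩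
    | add x y _ _ hx hy =>
      obtain ⟨M, hM⟩ := hx
      obtain ⟨N, hN⟩ := hy
      exact ⟨max M N, add_mem (eigenFiltration_mono (by simp) hM)
        (eigenFiltration_mono (by simp) hN)⟩

theorem mem_eigenspace_of_commutator {f : Module.End K V} {n c : K} (hf : D * f - f * D = n • f)
    {v : V} (hv : v ∈ D.eigenspace c) : f v ∈ D.eigenspace (c + n) := by
  rw [Module.End.mem_eigenspace_iff] at hv ⊢
  have := LinearMap.congr_fun hf v
  rw [LinearMap.sub_apply, Module.End.mul_apply, Module.End.mul_apply, hv, map_smul,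
    LinearMap.smul_apply, sub_eq_iff_eq_add] at this
  rw [this, add_smul, add_comm]

theorem mem_degSub_of_commutator {f : Module.End K V} {n : ℤ}
    (hf : D * f - f * D = (n : K) • f) : f ∈ degSub (eigenFiltration D) n := by
  intro M v hv
  suffices h : eigenFiltration D M ≤ (eigenFiltration D (M - n)).comap f from h hv
  refine iSup₂_le fun c hc x hx =>
    eigenspace_le_eigenFiltration (fun n' hn' => ?_) (mem_eigenspace_of_commutator hf hx)
  rw [add_assoc, ← Int.cast_add]
  exact hc (n + n') (by omega)

section Monomials

variable (g : κ → Module.End K V) (deg : κ → ℤ)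

/-- The subspace spanned by the images of `v` under all monomials in the operators `g y`. -/
def monomialSpan (v : V) : Submodule K V :=
  Submodule.span K (Set.range fun L : List κ => (L.map g).prod v)

/-- A vector is singular if it is killed by all monomials of positive degree, where `g y` has
degree `deg y`. -/
def IsSingular (v : V) : Prop :=
  ∀ L : List κ, 0 < (L.map deg).sum → (L.map g).prod v = 0

variable {g deg}

theorem self_mem_monomialSpan (v : V) : v ∈ monomialSpan g v :=
  Submodule.subset_span ⟨[], rfl⟩

theorem mem_stabilizer_monomialSpan (v : V) (y : κ) : g y ∈ stabilizer (monomialSpan g v) := by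
  suffices h : monomialSpan g v ≤ (monomialSpan g v).comap (g y) from h
  refine Submodule.span_le.mpr ?_
  rintro _ ⟨L, rfl⟩
  exact Submodule.subset_span ⟨y :: L, by simp⟩

theorem list_prod_mem_stabilizer {S : Submodule K V} (hS : ∀ y, g y ∈ stabilizer S) (L : List κ) :
    (L.map g).prod ∈ stabilizer S :=
  list_prod_mem fun _ hf => by
    obtain ⟨y, -, rfl⟩ := List.mem_map.mp hf
    exact hS y

theorem monomialSpan_le {S : Submodule K V} (hS : ∀ y, g y ∈ stabilizer S) {v : V} (hv : v ∈ S) :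
    monomialSpan g v ≤ S := by
  refine Submodule.span_le.mpr ?_
  rintro _ ⟨L, rfl⟩
  exact list_prod_mem_stabilizer hS L v hv

section Homogeneous

variable (hg : ∀ y, D * g y - g y * D = (deg y : K) • g y)
include hg

theorem commutator_list_prod (L : List κ) :
    D * (L.map g).prod - (L.map g).prod * D = ((L.map deg).sum : K) • (L.map g).prod := by
  induction L with
  | nil => simp
  | cons y L ih =>
    rw [List.map_cons, List.map_cons, List.prod_cons, List.sum_cons]
    calc D * (g y * (L.map g).prod) - g y * (L.map g).prod * D
        = (D * g y - g y * D) * (L.map g).prod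
          + g y * (D * (L.map g).prod - (L.map g).prod * D) := by noncomm_ring
      _ = _ := by rw [hg, ih, smul_mul_assoc, mul_smul_comm, ← add_smul, Int.cast_add]

theorem list_prod_mem_eigenspace {c : K} {v : V} (hv : v ∈ D.eigenspace c) (L : List κ) :
    (L.map g).prod v ∈ D.eigenspace (c + ((L.map deg).sum : ℤ)) :=
  mem_eigenspace_of_commutator (commutator_list_prod hg L) hv

theorem mem_stabilizer_monomialSpan_of_mem_eigenspace {c : K} {v : V} (hv : v ∈ D.eigenspace c) :
    D ∈ stabilizer (monomialSpan g v) := by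
  suffices h : monomialSpan g v ≤ (monomialSpan g v).comap D from h
  refine Submodule.span_le.mpr ?_
  rintro _ ⟨L, rfl⟩
  have := Module.End.mem_eigenspace_iff.mp (list_prod_mem_eigenspace hg hv L)
  rw [SetLike.mem_coe, Submodule.mem_comap, this]
  exact Submodule.smul_mem _ _ (Submodule.subset_span ⟨L, rfl⟩)

theorem IsSingular.component {f : K →₀ V} (hf : ∀ c, f c ∈ D.eigenspace c)
    (hsing : IsSingular g deg (f.sum fun _ v => v)) (c : K) : IsSingular g deg (f c) := by
  intro L hL
  by_cases hc : c ∈ f.support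
  · have hind := D.eigenspaces_iSupIndep.comp (add_left_injective (((L.map deg).sum : ℤ) : K))
    rw [iSupIndep_iff_finsetSum_eq_zero_imp_eq_zero] at hind
    refine hind f.support (fun c => (L.map g).prod (f c))
      (fun c _ => list_prod_mem_eigenspace hg (hf c) L) ?_ c hc
    rw [← map_sum]
    exact hsing L hL
  · rw [Finsupp.notMem_support_iff.mp hc, map_zero]

theorem IsSingular.monomialSpan_le {c : K} {v : V} (hsing : IsSingular g deg v)
    (hv : v ∈ D.eigenspace c) : monomialSpan g v ≤ ⨆ n : ℕ, D.eigenspace (c - n) := by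
  refine Submodule.span_le.mpr ?_
  rintro _ ⟨L, rfl⟩
  by_cases hL : 0 < (L.map deg).sum
  · simp only [hsing L hL]
    exact zero_mem _
  · obtain ⟨n, hn⟩ := Int.eq_ofNat_of_zero_le (show 0 ≤ -(L.map deg).sum by omega)
    refine Submodule.mem_iSup_of_mem n ?_
    have := list_prod_mem_eigenspace hg hv L
    rwa [neg_eq_iff_eq_neg.mp hn, Int.cast_neg, Int.cast_natCast, ← sub_eq_add_neg] at this

end Homogeneous

theorem exists_eq_sub_natCast {c c' : K} (htop : (⨆ n : ℕ, D.eigenspace (c - n)) = ⊤) {v : V}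
    (hv : v ∈ D.eigenspace c') (hv0 : v ≠ 0) : ∃ n : ℕ, c' = c - n := by
  by_contra! hne
  have hle : (⊤ : Submodule K V) ≤ ⨆ (j : K) (_ : j ≠ c'), D.eigenspace j :=
    htop ▸ iSup_le fun n => le_iSup₂_of_le (c - n) (hne n).symm le_rfl
  have hbot := disjoint_top.mp ((D.eigenspaces_iSupIndep c').mono_right hle)
  exact hv0 ((Submodule.mem_bot K).mp (hbot ▸ hv))

variable [CharZero K]

/-- Each nonzero component generates `V` from the top degree downwards, so that any two components
have the same degree. -/
theorem IsSingular.exists_mem_eigenspace (hgr : (⨆ a : K, D.eigenspace a) = ⊤)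
    (hg : ∀ y, D * g y - g y * D = (deg y : K) • g y)
    (hcyc : ∀ c, ∀ w ∈ D.eigenspace c, w ≠ 0 → monomialSpan g w = ⊤) {v : V}
    (hsing : IsSingular g deg v) (hv0 : v ≠ 0) : ∃ c, v ∈ D.eigenspace c := by
  obtain ⟨f, hf, rfl⟩ := (Submodule.mem_iSup_iff_exists_finsupp _ _).mp
    (show v ∈ ⨆ a : K, D.eigenspace a from hgr ▸ Submodule.mem_top)
  have hdeg : ∀ c, f c ≠ 0 → ∀ c', f c' ≠ 0 → ∃ n : ℕ, c' = c - n := fun c hc c' hc' => by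
    refine exists_eq_sub_natCast (top_le_iff.mp ?_) (hf c') hc'
    rw [← hcyc c (f c) (hf c) hc]
    exact (hsing.component hg hf c).monomialSpan_le hg (hf c)
  obtain ⟨c, hc⟩ : ∃ c, f c ≠ 0 := by
    by_contra! h0
    exact hv0 (by simp [Finsupp.sum, h0])
  refine ⟨c, ?_⟩
  rw [Finsupp.sum_eq_single c (fun c' hc' hne => absurd ?_ hne) fun _ => rfl]
  · exact hf c
  obtain ⟨n, hn⟩ := hdeg c hc c' hc'
  obtain ⟨n', hn'⟩ := hdeg c' hc' c hc
  have hsum : ((n + n' : ℕ) : K) = 0 := by push_cast; linear_combination hn + hn'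
  obtain ⟨rfl, -⟩ := Nat.add_eq_zero_iff.mp (Nat.cast_eq_zero.mp hsum)
  rw [hn, Nat.cast_zero, sub_zero]

theorem eq_top_of_stable_of_graded (hgr : (⨆ a : K, D.eigenspace a) = ⊤)
    (htr : ∀ a : K, ∃ n₀ : ℕ, ∀ n : ℕ, n₀ < n → D.eigenspace (a + n) = ⊥)
    (hg : ∀ y, D * g y - g y * D = (deg y : K) • g y)
    (hirr : ∀ S : Submodule K V, S ≠ ⊥ → (∀ y, g y ∈ stabilizer S) → D ∈ stabilizer S → S = ⊤)
    {S : Submodule K V} (hS : S ≠ ⊥) (hSg : ∀ y, g y ∈ stabilizer S) : S = ⊤ := by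
  have hcyc : ∀ c, ∀ w ∈ D.eigenspace c, w ≠ 0 → monomialSpan g w = ⊤ := fun c w hw hw0 =>
    hirr _ (Submodule.ne_bot_iff _ |>.mpr ⟨w, self_mem_monomialSpan w, hw0⟩)
      (mem_stabilizer_monomialSpan w) (mem_stabilizer_monomialSpan_of_mem_eigenspace hg hw)
  obtain ⟨M, v, hvS, hvM, hv0, hmin⟩ :=
    (isTruncFiltration_eigenFiltration hgr htr).exists_minimal hS
  have hsing : IsSingular g deg v := fun L hL =>
    hmin (M - (L.map deg).sum) (by omega) _ (list_prod_mem_stabilizer hSg L v hvS)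
      (mem_degSub_of_commutator (commutator_list_prod hg L) M v hvM)
  obtain ⟨c, hc⟩ := hsing.exists_mem_eigenspace hgr hg hcyc hv0
  exact top_le_iff.mp (hcyc c v hc hv0 ▸ monomialSpan_le hSg hvS)

end Monomials

end Grading

/-! ### `q`-numbers and the Heisenberg form -/

section QNumbers

theorem qpow_zero (h : ℂ) : qpow h 0 = 1 := by simp [qpow]

theorem qpow_add (h : ℂ) (x y : ℚ) : qpow h (x + y) = qpow h x * qpow h y := by
  simp only [qpow, Rat.cast_add, add_mul, Complex.exp_add]

/-- The character `x ↦ q^x` of the additive group of the rational numbers. -/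
def qChar (h : ℂ) : AddChar ℚ ℂ where
  toFun := qpow h
  map_zero_eq_one' := qpow_zero h
  map_add_eq_mul' := qpow_add h

theorem qChar_pow_den (h : ℂ) (x : ℚ) : qChar h x ^ x.den = Complex.exp h ^ x.num := by
  rw [← Complex.exp_int_mul, ← AddChar.map_nsmul_eq_pow, nsmul_eq_mul, Rat.den_mul_eq_num]
  simp [qChar, qpow]

theorem qChar_injective {h : ℂ} (hq : ∀ n : ℕ, 0 < n → Complex.exp h ^ n ≠ 1) :
    Function.Injective (qChar h) := by
  suffices hker : ∀ x, qChar h x = 1 → x = 0 from fun x y hxy => sub_eq_zero.mp <| hker _ <| by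
    rw [AddChar.map_sub_eq_div, hxy, div_self (show qChar h y ≠ 0 from Complex.exp_ne_zero _)]
  intro x hx
  have hnum : Complex.exp h ^ x.num = 1 := by rw [← qChar_pow_den, hx, one_pow]
  by_contra hx0
  refine hq _ (Int.natAbs_pos.mpr (Rat.num_ne_zero.mpr hx0)) ?_
  obtain habs | habs := Int.natAbs_eq x.num <;> rw [habs] at hnum
  · rwa [zpow_natCast] at hnum
  · rwa [zpow_neg, zpow_natCast, inv_eq_one] at hnum

theorem qnum_eq (h : ℂ) (x : ℚ) : qnum h x = oddPart (qChar h) x / oddPart (qChar h) 1 := rfl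

theorem qnum_neg (h : ℂ) (x : ℚ) : qnum h (-x) = -qnum h x := by
  rw [qnum_eq, qnum_eq, oddPart_neg, neg_div]

theorem qnum_ne_zero {h : ℂ} (hq : Function.Injective (qChar h)) {x : ℚ} (hx : x ≠ 0) :
    qnum h x ≠ 0 :=
  div_ne_zero (oddPart_ne_zero hq hx) (oddPart_ne_zero hq one_ne_zero)

/-- The matrix of the brackets `[a_i(m), a_j(-m)] = [(α_i|α_j) m] / m * [k m]` in level `k`. -/
def heisenbergForm (T : DynkinType) (h : ℂ) (k : ℚ) (m : ℕ+) :
    Matrix (Fin T.rank) (Fin T.rank) ℂ :=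
  .of fun i j => qnum h (T.form i j * m) / m * qnum h (k * m)

theorem heisenbergForm_eq_smul (T : DynkinType) (h : ℂ) (k : ℚ) (m : ℕ+) :
    heisenbergForm T h k m = (qnum h (k * m) / (m * oddPart (qChar h) 1)) •
      oddForm ((qChar h).mulShift (m : ℚ)) T := by
  ext i j
  have hshift : oddPart ((qChar h).mulShift (m : ℚ)) (T.form i j)
      = oddPart (qChar h) (T.form i j * m) := by
    simp only [oddPart, AddChar.mulShift_apply, mul_neg, mul_comm]
  simp only [heisenbergForm, oddForm, Matrix.smul_apply, Matrix.of_apply, smul_eq_mul, hshift,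
    qnum_eq h (T.form i j * m)]
  ring

theorem isUnit_det_heisenbergForm (T : DynkinType) {h : ℂ} (hq : Function.Injective (qChar h))
    {k : ℚ} (hk : k ≠ 0) (m : ℕ+) : IsUnit (heisenbergForm T h k m).det := by
  have hm : (m : ℚ) ≠ 0 := by exact_mod_cast m.ne_zero
  have hshift : Function.Injective ((qChar h).mulShift (m : ℚ)) :=
    hq.comp (mul_right_injective₀ hm)
  have hscalar : qnum h (k * m) / (m * oddPart (qChar h) 1) ≠ 0 :=
    div_ne_zero (qnum_ne_zero hq (mul_ne_zero hk hm))
      (mul_ne_zero (by exact_mod_cast m.ne_zero) (oddPart_ne_zero hq one_ne_zero))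
  rw [heisenbergForm_eq_smul, Matrix.det_smul]
  exact (isUnit_iff_ne_zero.mpr (pow_ne_zero _ hscalar)).mul (isUnit_det_oddForm hshift T)

/-- The coefficient `c` in the relation `[a_i(m), x_j^ε(n)] = c x_j^ε(m + n)` in level `k`. -/
def axCoeff (T : DynkinType) (h : ℂ) (k : ℚ) (ε : ℤˣ) (i j : Fin T.rank) (m : ℤ) : ℂ :=
  ((ε : ℤ) : ℂ) * (qnum h (T.form i j * m) / m) * qpow h (-(((ε : ℤ) : ℚ) * k * |m| / 2))

theorem axCoeff_neg (T : DynkinType) (h : ℂ) (k : ℚ) (ε : ℤˣ) (i j : Fin T.rank) (m : ℤ) :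
    axCoeff T h k ε i j (-m) = axCoeff T h k ε i j m := by
  simp only [axCoeff, Int.cast_neg, mul_neg, qnum_neg, neg_div_neg_eq, abs_neg]

end QNumbers

/-! ### The action of the generators -/

section Operators

variable {T : DynkinType} {h : ℂ} {k : ℚ} {V : Type*} [AddCommGroup V] [Module ℂ V]
  [Module (Uq T h) V] [IsScalarTower ℂ (Uq T h) V]

theorem op_eq_of_rel {u w : FreeAlgebra ℂ (Gen T.rank)} (hr : Rel T h u w) :
    op T h V u = op T h V w := by
  rw [op, op, Uq.mk, RingQuot.mkAlgHom_rel ℂ hr]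

@[simp] theorem op_mul (u w : FreeAlgebra ℂ (Gen T.rank)) :
    op T h V (u * w) = op T h V u * op T h V w := by simp [op]

@[simp] theorem op_add (u w : FreeAlgebra ℂ (Gen T.rank)) :
    op T h V (u + w) = op T h V u + op T h V w := by simp [op]

@[simp] theorem op_sub (u w : FreeAlgebra ℂ (Gen T.rank)) :
    op T h V (u - w) = op T h V u - op T h V w := by simp [op]

@[simp] theorem op_smul (c : ℂ) (u : FreeAlgebra ℂ (Gen T.rank)) :
    op T h V (c • u) = c • op T h V u := by simp [op]

@[simp] theorem op_one : op T h V 1 = 1 := by simp [op]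

@[simp] theorem op_zero : op T h V 0 = 0 := by simp [op]

@[simp] theorem op_pow (u : FreeAlgebra ℂ (Gen T.rank)) (n : ℕ) :
    op T h V (u ^ n) = op T h V u ^ n := by simp [op]

theorem dOp_commutator_aOp (i : Fin T.rank) (n : ℤ) :
    dOp T h V * aOp T h V i n - aOp T h V i n * dOp T h V = (n : ℂ) • aOp T h V i n := by
  by_cases hn : n = 0
  · simp [aOp, Free.a, hn]
  · have hrel := op_eq_of_rel (V := V) (Rel.d_a (T := T) (h := h) i n hn)
    rwa [op_sub, op_mul, op_mul, op_smul] at hrel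

theorem dOp_commutator_xOp (ε : ℤˣ) (i : Fin T.rank) (n : ℤ) :
    dOp T h V * xOp T h V ε i n - xOp T h V ε i n * dOp T h V = (n : ℂ) • xOp T h V ε i n := by
  have hrel := op_eq_of_rel (V := V) (Rel.d_x (T := T) (h := h) ε i n)
  rwa [op_sub, op_mul, op_mul, op_smul] at hrel

theorem commute_kOp_dOp (i : Fin T.rank) : Commute (kOp T h V i) (dOp T h V) := by
  have hrel := op_eq_of_rel (V := V) (Rel.k_d (T := T) (h := h) i)
  rwa [op_mul, op_mul] at hrel

/-- The operator `k_i` as an automorphism. -/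
def kUnit (T : DynkinType) (h : ℂ) (V : Type*) [AddCommGroup V] [Module ℂ V]
    [Module (Uq T h) V] [IsScalarTower ℂ (Uq T h) V] (i : Fin T.rank) : (Module.End ℂ V)ˣ where
  val := kOp T h V i
  inv := op T h V (Free.g (.kInv i))
  val_inv := by rw [kOp, ← op_mul, op_eq_of_rel (Rel.k_mul_inv i), op_one]
  inv_val := by rw [kOp, ← op_mul, op_eq_of_rel (Rel.inv_mul_k i), op_one]

/-- The filtration of a module by the degree with respect to `d`. -/
abbrev degFiltration (T : DynkinType) (h : ℂ) (V : Type*) [AddCommGroup V] [Module ℂ V]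
    [Module (Uq T h) V] [IsScalarTower ℂ (Uq T h) V] : ℤ → Submodule ℂ V :=
  eigenFiltration (dOp T h V)

theorem aOp_mem_degSub (i : Fin T.rank) (n : ℤ) :
    aOp T h V i n ∈ degSub (degFiltration T h V) n :=
  mem_degSub_of_commutator (dOp_commutator_aOp i n)

theorem xOp_mem_degSub (ε : ℤˣ) (i : Fin T.rank) (n : ℤ) :
    xOp T h V ε i n ∈ degSub (degFiltration T h V) n :=
  mem_degSub_of_commutator (dOp_commutator_xOp ε i n)

/-- The degree of a generator with respect to `d`. -/
def Gen.deg {l : ℕ} : Gen l → ℤ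
  | .a _ n _ => n
  | .x _ _ n => n
  | _ => 0

/-- The modules of level `k` that are graded by `d` with degrees bounded above: the category
`InCategory` without finiteness of the weight spaces. -/
structure IsRestricted (T : DynkinType) (h : ℂ) (k : ℚ) (V : Type*) [AddCommGroup V] [Module ℂ V]
    [Module (Uq T h) V] [IsScalarTower ℂ (Uq T h) V] : Prop where
  level : op T h V (Free.g .gh) = qpow h (k / 2) • (1 : Module.End ℂ V)
  graded : (⨆ a : ℂ, (dOp T h V).eigenspace a) = ⊤
  truncated : ∀ a : ℂ, ∃ n₀ : ℕ, ∀ n : ℕ, n₀ < n → (dOp T h V).eigenspace (a + n) = ⊥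

theorem InCategory.isRestricted (hV : InCategory T h k V) : IsRestricted T h k V :=
  ⟨hV.level, hV.graded, hV.truncated⟩

namespace IsRestricted

theorem isTruncFiltration (hV : IsRestricted T h k V) :
    IsTruncFiltration (degFiltration T h V) :=
  isTruncFiltration_eigenFiltration hV.graded hV.truncated

theorem op_ghInv (hV : IsRestricted T h k V) :
    op T h V (Free.g .ghInv) = qpow h (-(k / 2)) • (1 : Module.End ℂ V) := by
  have hrel := op_eq_of_rel (V := V) (Rel.gh_mul_inv (T := T) (h := h))
  rw [op_mul, op_one, hV.level, smul_mul_assoc, one_mul] at hrel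
  rw [← hrel, smul_smul, ← qpow_add, neg_add_cancel, qpow_zero, one_smul]

theorem op_ghPow (hV : IsRestricted T h k V) (m : ℤ) :
    op T h V (Free.ghPow m) = qpow h (m * k / 2) • (1 : Module.End ℂ V) := by
  have hpow : ∀ (x : ℚ) (n : ℕ), (qpow h x • (1 : Module.End ℂ V)) ^ n = qpow h (n * x) • 1 :=
    fun x n => by
      rw [smul_pow, one_pow, ← nsmul_eq_mul]
      exact congrArg (· • _) ((qChar h).map_nsmul_eq_pow n x).symm
  rw [Free.ghPow]
  split_ifs with hm
  · lift m to ℕ using hm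
    rw [op_pow, hV.level, hpow, Int.toNat_natCast, Int.cast_natCast, mul_div_assoc]
  · obtain ⟨n, rfl⟩ : ∃ n : ℕ, m = -n := ⟨(-m).toNat, by omega⟩
    rw [op_pow, hV.op_ghInv, hpow, neg_neg, Int.toNat_natCast, Int.cast_neg, Int.cast_natCast,
      mul_div_assoc, neg_mul, mul_neg]

theorem aOp_commutator_aOp (hV : IsRestricted T h k V) (i j : Fin T.rank) {m n : ℤ} (hm : m ≠ 0)
    (hn : n ≠ 0) : aOp T h V i m * aOp T h V j n - aOp T h V j n * aOp T h V i m
      = if m + n = 0 then (qnum h (T.form i j * m) / m * qnum h (k * m)) • 1 else 0 := by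
  have hrel := op_eq_of_rel (V := V) (Rel.a_a (T := T) (h := h) i j m n hm hn)
  rw [op_sub, op_mul, op_mul] at hrel
  rw [aOp, aOp, hrel]
  split_ifs
  · rw [op_smul, op_sub, hV.op_ghPow, hV.op_ghPow, ← sub_smul, smul_smul, qnum.eq_1 h (k * m),
      show ((2 * m : ℤ) : ℚ) * k / 2 = k * m by push_cast; ring,
      show ((-(2 * m) : ℤ) : ℚ) * k / 2 = -(k * m) by push_cast; ring, mul_div_assoc']
    congr 1
    ring
  · exact op_zero

theorem commute_aOp (hV : IsRestricted T h k V) (i j : Fin T.rank) {m n : ℤ} (hm : m ≠ 0)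
    (hn : n ≠ 0) (hmn : m + n ≠ 0) : Commute (aOp T h V i m) (aOp T h V j n) :=
  sub_eq_zero.mp (by rw [hV.aOp_commutator_aOp i j hm hn, if_neg hmn])

theorem aOp_commutator_xOp (hV : IsRestricted T h k V) (ε : ℤˣ) (i j : Fin T.rank) {m : ℤ}
    (hm : m ≠ 0) (n : ℤ) : aOp T h V i m * xOp T h V ε j n - xOp T h V ε j n * aOp T h V i m
      = axCoeff T h k ε i j m • xOp T h V ε j (m + n) := by
  have hrel := op_eq_of_rel (V := V) (Rel.a_x (T := T) (h := h) ε i j m n hm)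
  rw [op_sub, op_mul, op_mul, op_smul, op_mul, hV.op_ghPow, smul_mul_assoc, one_mul,
    smul_smul] at hrel
  rw [aOp, xOp, hrel, xOp, axCoeff]
  congr 3
  push_cast
  ring

theorem dOp_commutator (hV : IsRestricted T h k V) (y : Gen T.rank) :
    dOp T h V * op T h V (Free.g y) - op T h V (Free.g y) * dOp T h V
      = (y.deg : ℂ) • op T h V (Free.g y) := by
  have hzero : ∀ {f : Module.End ℂ V}, Commute f (dOp T h V) →
      dOp T h V * f - f * dOp T h V = ((0 : ℤ) : ℂ) • f := fun hf => by
    rw [hf.eq, sub_self, Int.cast_zero, zero_smul]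
  cases y with
  | gh => exact hzero (hV.level ▸ (Commute.one_left _).smul_left _)
  | ghInv => exact hzero (hV.op_ghInv ▸ (Commute.one_left _).smul_left _)
  | k i => exact hzero (commute_kOp_dOp i)
  | kInv i => exact hzero (Commute.units_inv_left (u := kUnit T h V i) (commute_kOp_dOp i))
  | d => exact hzero (Commute.refl _)
  | a i n hn =>
    have hcomm := dOp_commutator_aOp (V := V) (h := h) i n
    rwa [aOp, Free.a, dif_pos hn] at hcomm
  | x ε i n => exact dOp_commutator_xOp ε i n

theorem isHeisenbergSystem (hV : IsRestricted T h k V) (hq : Function.Injective (qChar h))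
    (hk : k ≠ 0) : IsHeisenbergSystem (degFiltration T h V) (heisenbergForm T h k)
      (fun i => aOp T h V i.1 i.2) (fun i => aOp T h V i.1 (-i.2)) where
  isUnit_det := isUnit_det_heisenbergForm T hq hk
  ann_mem _ := aOp_mem_degSub _ _
  cre_mem _ := aOp_mem_degSub _ _
  ann_comm i j := hV.commute_aOp _ _ (by simp) (by simp) (by positivity)
  cre_comm i j := hV.commute_aOp _ _ (by simp) (by simp) (by have := i.2.pos; omega)
  ann_cre i j := by
    simp only [hV.aOp_commutator_aOp _ _ (Int.natCast_ne_zero.mpr i.2.ne_zero)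
      (neg_ne_zero.mpr (Int.natCast_ne_zero.mpr j.2.ne_zero)), add_neg_eq_zero, Nat.cast_inj,
      PNat.coe_inj, heisenbergForm, Matrix.of_apply, Int.cast_natCast]

end IsRestricted

end Operators

/-! ### The quantum `Z`-operators -/

section ZOperators

variable {T : DynkinType} {h : ℂ} {k : ℚ} {V : Type*} [AddCommGroup V] [Module ℂ V]
  [Module (Uq T h) V] [IsScalarTower ℂ (Uq T h) V]

theorem coeff_EPlus_mem {S : Subalgebra ℂ (Module.End ℂ V)} {i : Fin T.rank}
    (ha : ∀ m : ℕ+, aOp T h V i m ∈ S) (ε η : ℤˣ) (r : ℕ) :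
    PowerSeries.coeff r (EPlus T h k V ε η i) ∈ S :=
  coeff_expSum_mem _ (fun n hn => ha ⟨n, hn⟩) r

theorem coeff_EMinus_mem {S : Subalgebra ℂ (Module.End ℂ V)} {i : Fin T.rank}
    (ha : ∀ m : ℕ+, aOp T h V i (-m) ∈ S) (ε : ℤˣ) (p : ℕ) :
    PowerSeries.coeff p (EMinus T h k V ε i) ∈ S :=
  coeff_expSum_mem _ (fun n hn => ha ⟨n, hn⟩) p

theorem coeff_EPlus_mem_degSub (ε η : ℤˣ) (i : Fin T.rank) (r : ℕ) :
    PowerSeries.coeff r (EPlus T h k V ε η i) ∈ degSub (degFiltration T h V) r := by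
  have : SetLike.GradedMonoid fun n : ℕ => degSub (degFiltration T h V) n :=
    { one_mem := one_mem_degSub
      mul_mem := fun _ _ _ _ hf hg => by
        rw [Nat.cast_add]
        exact mul_mem_degSub hf hg }
  exact coeff_expSum_mem_of_graded (A := fun n : ℕ => degSub (degFiltration T h V) n) _
    (fun n => aOp_mem_degSub i n) r

theorem mem_vacuum {v : V} : v ∈ vacuum T h k V ↔ ∀ (ε η : ℤˣ) (i : Fin T.rank) (N : ℕ), 0 < N →
    PowerSeries.coeff N (EPlus T h k V ε η i) v = 0 := by
  refine forall₄_congr fun ε η i N => ?_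
  rcases Nat.eq_zero_or_pos N with rfl | hN
  · simp [EPlus]
  · simp [hN, hN.ne']

theorem vacuum_eq_commonKernel (hq : Function.Injective (qChar h)) (hk : k ≠ 0) :
    vacuum T h k V = commonKernel fun i : Fin T.rank × ℕ+ => aOp T h V i.1 i.2 := by
  ext v
  have hEPlus : ∀ (ε η : ℤˣ) (i : Fin T.rank),
      (∀ N, 0 < N → PowerSeries.coeff N (EPlus T h k V ε η i) v = 0) ↔
        ∀ n : ℕ, 0 < n → aOp T h V i n v = 0 := fun ε η i =>
    coeff_expSum_apply_eq_zero_iff fun n hn => mul_ne_zero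
      (mul_ne_zero (Int.cast_ne_zero.mpr ε.ne_zero) (Int.cast_ne_zero.mpr η.ne_zero))
      (div_ne_zero (Complex.exp_ne_zero _)
        (qnum_ne_zero hq (mul_ne_zero hk (Nat.cast_ne_zero.mpr hn.ne'))))
  simp only [mem_vacuum, mem_commonKernel, hEPlus, Prod.forall, forall_const]
  exact ⟨fun hv i n => hv i n n.pos, fun hv i n hn => hv i ⟨n, hn⟩⟩

namespace IsRestricted

theorem aOp_commutator_EMinus (hV : IsRestricted T h k V) (hq : Function.Injective (qChar h))
    (hk : k ≠ 0) (ε : ℤˣ) (i j : Fin T.rank) {m : ℕ} (hm : 0 < m) (p : ℕ) :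
    aOp T h V j m * PowerSeries.coeff p (EMinus T h k V ε i)
      - PowerSeries.coeff p (EMinus T h k V ε i) * aOp T h V j m
      = if m ≤ p then (-axCoeff T h k ε j i m) • PowerSeries.coeff (p - m) (EMinus T h k V ε i)
        else 0 := by
  have hkm : qnum h (k * m) ≠ 0 := qnum_ne_zero hq (mul_ne_zero hk (Nat.cast_ne_zero.mpr hm.ne'))
  have hbracket : ∀ n : ℕ, 0 < n →
      aOp T h V j m * aOp T h V i (-n) - aOp T h V i (-n) * aOp T h V j m
      = if n = m then (qnum h (T.form j i * m) / m * qnum h (k * m)) • (1 : Module.End ℂ V)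
        else 0 := fun n hn => by
    rw [hV.aOp_commutator_aOp j i (by omega) (by omega)]
    exact if_congr (by omega) (by push_cast; rfl) rfl
  refine (commutator_coeff_expSum hm _ hbracket p).trans (if_congr Iff.rfl ?_ rfl)
  congr 1
  simp only [axCoeff, Int.cast_natCast, Nat.abs_cast]
  field_simp

theorem aOp_neg_commutator_EPlus (hV : IsRestricted T h k V) (hq : Function.Injective (qChar h))
    (hk : k ≠ 0) (ε : ℤˣ) (i j : Fin T.rank) {m : ℕ} (hm : 0 < m) (r : ℕ) :
    aOp T h V j (-m) * PowerSeries.coeff r (EPlus T h k V ε 1 i)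
      - PowerSeries.coeff r (EPlus T h k V ε 1 i) * aOp T h V j (-m)
      = if m ≤ r then (-axCoeff T h k ε j i m) • PowerSeries.coeff (r - m) (EPlus T h k V ε 1 i)
        else 0 := by
  have hkm : qnum h (k * m) ≠ 0 := qnum_ne_zero hq (mul_ne_zero hk (Nat.cast_ne_zero.mpr hm.ne'))
  have hbracket : ∀ n : ℕ, 0 < n →
      aOp T h V j (-m) * aOp T h V i n - aOp T h V i n * aOp T h V j (-m)
      = if n = m then (-(qnum h (T.form j i * m) / m * qnum h (k * m))) • (1 : Module.End ℂ V)
        else 0 := fun n hn => by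
    rw [hV.aOp_commutator_aOp j i (by omega) (by omega)]
    refine if_congr (by omega) ?_ rfl
    push_cast
    rw [mul_neg, mul_neg, qnum_neg, qnum_neg, neg_div_neg_eq, mul_neg]
  refine (commutator_coeff_expSum hm _ hbracket r).trans (if_congr Iff.rfl ?_ rfl)
  congr 1
  simp only [axCoeff, Int.cast_natCast, Nat.abs_cast, Units.val_one, Int.cast_one]
  field_simp

theorem commute_aOp_EPlus (hV : IsRestricted T h k V) (ε η : ℤˣ) (i j : Fin T.rank) {m : ℕ}
    (hm : 0 < m) (r : ℕ) : Commute (aOp T h V j m) (PowerSeries.coeff r (EPlus T h k V ε η i)) :=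
  commute_coeff_expSum _ (fun _ _ => hV.commute_aOp j i (by omega) (by omega) (by omega)) r

theorem commute_aOp_neg_EMinus (hV : IsRestricted T h k V) (ε : ℤˣ) (i j : Fin T.rank) {m : ℕ}
    (hm : 0 < m) (p : ℕ) :
    Commute (aOp T h V j (-m)) (PowerSeries.coeff p (EMinus T h k V ε i)) :=
  commute_coeff_expSum _ (fun _ _ => hV.commute_aOp j i (by omega) (by omega) (by omega)) p

theorem zTerm_support_finite (hV : IsRestricted T h k V) (ε : ℤˣ) (i : Fin T.rank) (n : ℤ)
    (v : V) : (Function.support (ZTerm T h k ε i n v)).Finite :=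
  dressTerm_support_finite (em := fun p => PowerSeries.coeff p (EMinus T h k V ε i))
    hV.isTruncFiltration (xOp_mem_degSub ε i) (coeff_EPlus_mem_degSub ε 1 i) n v

theorem isLinearMap_zOp (hV : IsRestricted T h k V) (ε : ℤˣ) (i : Fin T.rank) (n : ℤ) :
    IsLinearMap ℂ (ZOp T h k ε i n : V → V) :=
  isLinearMap_dressSum (em := fun p => PowerSeries.coeff p (EMinus T h k V ε i))
    hV.isTruncFiltration (xOp_mem_degSub ε i) (coeff_EPlus_mem_degSub ε 1 i) n

/-- The contribution of `x_i^ε(z)` to the commutator is cancelled by that of `E_-^ε(α_i, z)`. -/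
theorem aOp_zOp (hV : IsRestricted T h k V) (hq : Function.Injective (qChar h)) (hk : k ≠ 0)
    (ε : ℤˣ) (i j : Fin T.rank) (m : ℕ+) (n : ℤ) (v : V) :
    aOp T h V j m (ZOp T h k ε i n v) = ZOp T h k ε i n (aOp T h V j m v) := by
  have hcomm := commutator_dressSum (t := 0) (d := 0) hV.isTruncFiltration (xOp_mem_degSub ε i)
    (coeff_EPlus_mem_degSub ε 1 i) (hV.aOp_commutator_EMinus hq hk ε i j m.pos)
    (hV.aOp_commutator_xOp ε j i (by simp)) (fun r => by
      rw [(hV.commute_aOp_EPlus ε 1 i j m.pos r).eq, sub_self, zero_smul, ite_self]) n v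
  rwa [neg_smul, zero_smul, add_zero, neg_add_cancel, sub_eq_zero] at hcomm

/-- The contribution of `x_i^ε(z)` to the commutator is cancelled by that of `E_+^ε(α_i, z)`. -/
theorem aOp_neg_zOp (hV : IsRestricted T h k V) (hq : Function.Injective (qChar h)) (hk : k ≠ 0)
    (ε : ℤˣ) (i j : Fin T.rank) (m : ℕ+) (n : ℤ) (v : V) :
    aOp T h V j (-m) (ZOp T h k ε i n v) = ZOp T h k ε i n (aOp T h V j (-m) v) := by
  have hcomm := commutator_dressSum (s := 0) (b := 0) hV.isTruncFiltration (xOp_mem_degSub ε i)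
    (coeff_EPlus_mem_degSub ε 1 i) (fun p => by
      rw [(hV.commute_aOp_neg_EMinus ε i j m.pos p).eq, sub_self, zero_smul, ite_self])
    (hV.aOp_commutator_xOp ε j i (by simp)) (hV.aOp_neg_commutator_EPlus hq hk ε i j m.pos) n v
  rwa [axCoeff_neg, zero_smul, zero_add, neg_smul, ← sub_eq_add_neg, ← sub_eq_add_neg, sub_self,
    sub_eq_zero] at hcomm

theorem zStable_vacuum (hV : IsRestricted T h k V) (hq : Function.Injective (qChar h))
    (hk : k ≠ 0) : ZStable T h k V (vacuum T h k V) := by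
  intro ε i n v hv
  rw [vacuum_eq_commonKernel hq hk, mem_commonKernel] at hv ⊢
  intro j
  rw [hV.aOp_zOp hq hk, hv j, (hV.isLinearMap_zOp ε i n).map_zero]

end IsRestricted

end ZOperators

/-! ### Stable subspaces and irreducibility -/

section Irreducibility

variable {T : DynkinType} {h : ℂ} {k : ℚ} {V : Type*} [AddCommGroup V] [Module ℂ V]
  [Module (Uq T h) V] [IsScalarTower ℂ (Uq T h) V] {S W : Submodule ℂ V}

theorem op_mem_stabilizer (hS : ∀ y, op T h V (Free.g y) ∈ stabilizer S)
    (u : FreeAlgebra ℂ (Gen T.rank)) : op T h V u ∈ stabilizer S := by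
  induction u using FreeAlgebra.induction with
  | grade0 r =>
    rw [Algebra.algebraMap_eq_smul_one, op_smul, op_one]
    exact Subalgebra.smul_mem _ (one_mem _) r
  | grade1 y => exact hS y
  | mul a b ha hb =>
    rw [op_mul]
    exact mul_mem ha hb
  | add a b ha hb =>
    rw [op_add]
    exact add_mem ha hb

/-- A subspace that is stable under the generators, as a submodule over `Uq T h`. -/
def submoduleOfStable (S : Submodule ℂ V) (hS : ∀ y, op T h V (Free.g y) ∈ stabilizer S) :
    Submodule (Uq T h) V where
  toAddSubmonoid := S.toAddSubmonoid
  smul_mem' c v hv := by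
    obtain ⟨u, rfl⟩ := RingQuot.mkAlgHom_surjective ℂ (Rel T h) c
    exact op_mem_stabilizer hS u v hv

theorem eq_top_of_isSimpleModule [IsSimpleModule (Uq T h) V] (hS : S ≠ ⊥)
    (hSg : ∀ y, op T h V (Free.g y) ∈ stabilizer S) : S = ⊤ := by
  have hmem : ∀ v, v ∈ submoduleOfStable S hSg ↔ v ∈ S := fun _ => Iff.rfl
  rcases eq_bot_or_eq_top (submoduleOfStable S hSg) with hbot | htop
  · exact absurd (eq_bot_iff.mpr fun v hv => by simpa [hbot] using (hmem v).mpr hv) hS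
  · exact eq_top_iff.mpr fun v _ => (hmem v).mp (htop ▸ Submodule.mem_top)

namespace IsRestricted

theorem eq_top_of_stable (hV : IsRestricted T h k V) [IsSimpleModule (Uq T h) V] (hS : S ≠ ⊥)
    (hSg : ∀ y, y ≠ Gen.d → op T h V (Free.g y) ∈ stabilizer S) : S = ⊤ := by
  refine eq_top_of_stable_of_graded (g := fun y : {y : Gen T.rank // y ≠ Gen.d} =>
    op T h V (Free.g y.1)) hV.graded hV.truncated (fun y => hV.dOp_commutator y.1)
    (fun S hS hg hD => eq_top_of_isSimpleModule (T := T) (h := h) hS fun y => ?_) hS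
    fun y => hSg y.1 y.2
  by_cases hy : y = Gen.d
  · exact hy ▸ hD
  · exact hg ⟨y, hy⟩

theorem xOp_commutator_xOp (hV : IsRestricted T h k V) (i : Fin T.rank) (m : ℤ) :
    xOp T h V 1 i m * xOp T h V (-1) i (-m) - xOp T h V (-1) i (-m) * xOp T h V 1 i m
      = (oddPart (qChar h) (T.halfSq i))⁻¹ • (qpow h (m * k) • (kUnit T h V i : Module.End ℂ V)
          - qpow h (-(m * k)) • (↑(kUnit T h V i)⁻¹ : Module.End ℂ V)) := by
  have hrel := op_eq_of_rel (V := V) (Rel.xp_xm (T := T) (h := h) i i m (-m))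
  rw [if_pos rfl, add_neg_cancel, sub_neg_eq_add, ← two_mul, op_smul, op_sub, op_sub, op_mul,
    op_mul, op_mul, op_mul, hV.op_ghPow, hV.op_ghPow, Free.psi, if_pos le_rfl, Free.phi,
    if_pos le_rfl, Int.neg_zero, Int.toNat_zero, coeff_zero_expSeries, coeff_zero_expSeries,
    mul_one, mul_one, smul_mul_assoc, smul_mul_assoc, one_mul, one_mul] at hrel
  refine hrel.trans ?_
  rw [show ((2 * m : ℤ) : ℚ) * k / 2 = m * k by push_cast; ring,
    show ((-m - m : ℤ) : ℚ) * k / 2 = -(m * k) by push_cast; ring]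
  rfl

/-- The elements `k_i ∓ k_i⁻¹` are recovered from the brackets `[x_i^+(m), x_i^-(-m)]` with
`m = 0, 1`, since `q^{2k} ≠ 1`. -/
theorem kUnit_mem_stabilizer (hV : IsRestricted T h k V) (hq : Function.Injective (qChar h))
    (hk : k ≠ 0) (hx : ∀ ε i n, xOp T h V ε i n ∈ stabilizer S) (i : Fin T.rank) :
    (kUnit T h V i : Module.End ℂ V) ∈ stabilizer S ∧
      (↑(kUnit T h V i)⁻¹ : Module.End ℂ V) ∈ stabilizer S := by
  have hbracket : ∀ m : ℤ, qpow h (m * k) • (kUnit T h V i : Module.End ℂ V)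
      - qpow h (-(m * k)) • (↑(kUnit T h V i)⁻¹ : Module.End ℂ V) ∈ stabilizer S := fun m => by
    have hmem := sub_mem (mul_mem (hx 1 i m) (hx (-1) i (-m)))
      (mul_mem (hx (-1) i (-m)) (hx 1 i m))
    rwa [hV.xOp_commutator_xOp, ← Subalgebra.mem_toSubmodule, Submodule.smul_mem_iff _
      (inv_ne_zero (oddPart_ne_zero hq (halfSq_ne_zero T i)))] at hmem
  have hdiff : (kUnit T h V i : Module.End ℂ V) - ↑(kUnit T h V i)⁻¹ ∈ stabilizer S := by
    simpa only [Int.cast_zero, zero_mul, neg_zero, qpow_zero, one_smul] using hbracket 0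
  have hinv : (↑(kUnit T h V i)⁻¹ : Module.End ℂ V) ∈ stabilizer S := by
    refine (Submodule.smul_mem_iff (stabilizer S).toSubmodule (oddPart_ne_zero hq hk)).mp ?_
    rw [Subalgebra.mem_toSubmodule]
    convert sub_mem (hbracket 1) (Subalgebra.smul_mem _ hdiff (qpow h k)) using 1
    rw [Int.cast_one, one_mul, show oddPart (qChar h) k = qpow h k - qpow h (-k) from rfl]
    module
  exact ⟨sub_add_cancel (kUnit T h V i : Module.End ℂ V) _ ▸ add_mem hdiff hinv, hinv⟩

theorem op_g_mem_stabilizer (hV : IsRestricted T h k V) (hq : Function.Injective (qChar h))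
    (hk : k ≠ 0) (ha : ∀ i (m : ℕ+), aOp T h V i m ∈ stabilizer S)
    (ha' : ∀ i (m : ℕ+), aOp T h V i (-m) ∈ stabilizer S)
    (hx : ∀ ε i n, xOp T h V ε i n ∈ stabilizer S) (y : Gen T.rank) (hy : y ≠ Gen.d) :
    op T h V (Free.g y) ∈ stabilizer S := by
  cases y with
  | gh => exact hV.level ▸ Subalgebra.smul_mem _ (one_mem _) _
  | ghInv => exact hV.op_ghInv ▸ Subalgebra.smul_mem _ (one_mem _) _
  | k i => exact (hV.kUnit_mem_stabilizer hq hk hx i).1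
  | kInv i => exact (hV.kUnit_mem_stabilizer hq hk hx i).2
  | d => exact absurd rfl hy
  | a i n hn =>
    rw [show op T h V (Free.g (.a i n hn)) = aOp T h V i n by rw [aOp, Free.a, dif_pos hn]]
    obtain ⟨m, rfl | rfl⟩ := Int.eq_nat_or_neg n
    · exact ha i ⟨m, by omega⟩
    · exact ha' i ⟨m, by omega⟩
  | x ε i n => exact hx ε i n

theorem inf_vacuum_ne_bot (hV : IsRestricted T h k V) (hq : Function.Injective (qChar h))
    (hk : k ≠ 0) (hS : S ≠ ⊥) (ha : ∀ i (m : ℕ+), aOp T h V i m ∈ stabilizer S) :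
    S ⊓ vacuum T h k V ≠ ⊥ := by
  obtain ⟨M, v, hvS, hvM, hv0, hmin⟩ := hV.isTruncFiltration.exists_minimal hS
  refine (Submodule.ne_bot_iff _).mpr ⟨v, ⟨hvS, ?_⟩, hv0⟩
  rw [vacuum_eq_commonKernel hq hk]
  exact mem_commonKernel.mpr fun i => hmin _ (sub_lt_self _ (Int.natCast_pos.mpr i.2.pos)) _
    (ha _ _ v hvS) (aOp_mem_degSub _ _ _ v hvM)

/-- The subspace `U(ĥ⁻) W` generated by `W` under the creation operators `a_i(-m)`. -/
def creationOrbit (T : DynkinType) (h : ℂ) {V : Type*} [AddCommGroup V] [Module ℂ V]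
    [Module (Uq T h) V] [IsScalarTower ℂ (Uq T h) V] (W : Submodule ℂ V) : Submodule ℂ V :=
  orbit (Set.range fun i : Fin T.rank × ℕ+ => aOp T h V i.1 (-i.2)) W

theorem aOp_neg_mem_stabilizer_creationOrbit (i : Fin T.rank) (m : ℕ+) :
    aOp T h V i (-m) ∈ stabilizer (creationOrbit T h W) :=
  subset_stabilizer_orbit ⟨(i, m), rfl⟩

theorem aOp_mem_stabilizer_creationOrbit (hV : IsRestricted T h k V)
    (hq : Function.Injective (qChar h)) (hk : k ≠ 0) (hW : W ≤ vacuum T h k V) (i : Fin T.rank)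
    (m : ℕ+) : aOp T h V i m ∈ stabilizer (creationOrbit T h W) := by
  refine mem_stabilizer_orbit (fun w hw => ?_) ?_
  · rw [vacuum_eq_commonKernel hq hk] at hW
    rw [mem_commonKernel.mp (hW hw) (i, m)]
    exact zero_mem _
  · rintro _ ⟨j, rfl⟩ v hv hav
    have hcomm := LinearMap.congr_fun ((hV.isHeisenbergSystem hq hk).ann_cre (i, m) j) v
    rw [LinearMap.sub_apply, sub_eq_iff_eq_add] at hcomm
    refine hcomm ▸ add_mem ?_ (aOp_neg_mem_stabilizer_creationOrbit _ _ _ hav)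
    split_ifs
    · exact Submodule.smul_mem _ _ hv
    · exact zero_mem _

theorem zOp_mem_creationOrbit (hV : IsRestricted T h k V) (hq : Function.Injective (qChar h))
    (hk : k ≠ 0) (hWZ : ZStable T h k V W) (ε : ℤˣ) (i : Fin T.rank) (n : ℤ) {v : V}
    (hv : v ∈ creationOrbit T h W) : ZOp T h k ε i n v ∈ creationOrbit T h W := by
  suffices hZ : (hV.isLinearMap_zOp ε i n).mk' _ ∈ stabilizer (creationOrbit T h W) from hZ v hv
  refine mem_stabilizer_orbit (fun w hw => le_orbit (hWZ ε i n w hw)) ?_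
  rintro _ ⟨j, rfl⟩ v - hZv
  rw [IsLinearMap.mk'_apply, ← hV.aOp_neg_zOp hq hk]
  exact aOp_neg_mem_stabilizer_creationOrbit _ _ _ hZv

theorem xOp_mem_stabilizer_creationOrbit (hV : IsRestricted T h k V)
    (hq : Function.Injective (qChar h)) (hk : k ≠ 0) (hW : W ≤ vacuum T h k V)
    (hWZ : ZStable T h k V W) (ε : ℤˣ) (i : Fin T.rank) (n : ℤ) :
    xOp T h V ε i n ∈ stabilizer (creationOrbit T h W) :=
  mem_stabilizer_of_dressSum_mem hV.isTruncFiltration (xOp_mem_degSub ε i)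
    (coeff_EPlus_mem_degSub (k := k) ε 1 i) (coeff_zero_expSeries _) (coeff_zero_expSeries _)
    (coeff_EMinus_mem (aOp_neg_mem_stabilizer_creationOrbit i) ε)
    (coeff_EPlus_mem (hV.aOp_mem_stabilizer_creationOrbit hq hk hW i) ε 1)
    (fun n _ => hV.zOp_mem_creationOrbit hq hk hWZ ε i n) n

theorem creationOrbit_eq_top (hV : IsRestricted T h k V) (hq : Function.Injective (qChar h))
    (hk : k ≠ 0) [IsSimpleModule (Uq T h) V] (hW : W ≤ vacuum T h k V)
    (hWZ : ZStable T h k V W) (hW0 : W ≠ ⊥) : creationOrbit T h W = ⊤ :=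
  hV.eq_top_of_stable (ne_bot_of_le_ne_bot hW0 le_orbit) <| hV.op_g_mem_stabilizer hq hk
    (hV.aOp_mem_stabilizer_creationOrbit hq hk hW) aOp_neg_mem_stabilizer_creationOrbit
    (hV.xOp_mem_stabilizer_creationOrbit hq hk hW hWZ)

theorem eq_vacuum_of_zStable (hV : IsRestricted T h k V) (hq : Function.Injective (qChar h))
    (hk : k ≠ 0) [IsSimpleModule (Uq T h) V] (hW : W ≤ vacuum T h k V)
    (hWZ : ZStable T h k V W) (hW0 : W ≠ ⊥) : W = vacuum T h k V := by
  have hHeis := hV.isHeisenbergSystem hq hk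
  set cre := fun i : Fin T.rank × ℕ+ => aOp T h V i.1 (-i.2)
  have hdisj : vacuum T h k V ⊓ creationRange cre = ⊥ := by
    rw [vacuum_eq_commonKernel hq hk, ← hHeis.commonKernel_dualAnn]
    exact hHeis.isOscillatorSystem.commonKernel_inf_creationRange hV.isTruncFiltration
  have hcodisj : W ⊔ creationRange cre = ⊤ := by
    rw [eq_top_iff, ← hV.creationOrbit_eq_top hq hk hW hWZ hW0]
    refine orbit_le le_sup_left ?_
    rintro _ ⟨i, rfl⟩ v -
    exact Submodule.mem_sup_right (Submodule.mem_iSup_of_mem i ⟨v, rfl⟩)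
  calc W = W ⊔ creationRange cre ⊓ vacuum T h k V := by rw [inf_comm, hdisj, sup_bot_eq]
    _ = vacuum T h k V := by rw [← sup_inf_assoc_of_le _ hW, hcodisj, top_inf_eq]

theorem zIrreducible_vacuum (hV : IsRestricted T h k V) (hq : Function.Injective (qChar h))
    (hk : k ≠ 0) [IsSimpleModule (Uq T h) V] : ZIrreducible T h k V (vacuum T h k V) where
  stable := hV.zStable_vacuum hq hk
  ne_bot := by
    have : Nontrivial V := IsSimpleModule.nontrivial (Uq T h) V
    simpa using hV.inf_vacuum_ne_bot hq hk (S := ⊤) top_ne_bot fun _ _ _ _ => trivial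
  eq_bot_or_eq _ hW hWZ := or_iff_not_imp_left.mpr (hV.eq_vacuum_of_zStable hq hk hW hWZ)

theorem zStable_restrictScalars_inf (N : Submodule (Uq T h) V)
    (hW : ZStable T h k V W) : ZStable T h k V (N.restrictScalars ℂ ⊓ W) := fun ε i n w hw =>
  have hop : ∀ u, op T h V u ∈ stabilizer (N.restrictScalars ℂ) := fun _ _ => N.smul_mem _
  ⟨dressSum_mem (coeff_EMinus_mem (fun _ => hop _) ε) (fun _ => hop _)
    (coeff_EPlus_mem (fun _ => hop _) ε 1) n hw.1, hW ε i n w hw.2⟩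

theorem isSimpleModule_of_zIrreducible (hV : IsRestricted T h k V)
    (hq : Function.Injective (qChar h)) (hk : k ≠ 0)
    (hΩ : ZIrreducible T h k V (vacuum T h k V)) : IsSimpleModule (Uq T h) V := by
  have : Nontrivial V := (Submodule.nontrivial_iff ℂ).mp ⟨_, ⊥, hΩ.ne_bot⟩
  refine isSimpleModule_iff _ _ |>.mpr { eq_bot_or_eq_top := fun N => ?_ }
  refine or_iff_not_imp_left.mpr fun hN => ?_
  set S := N.restrictScalars ℂ with hS
  have hop : ∀ u, op T h V u ∈ stabilizer S := fun _ _ => N.smul_mem _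
  have hinf : S ⊓ vacuum T h k V = vacuum T h k V :=
    (hΩ.eq_bot_or_eq _ inf_le_right (zStable_restrictScalars_inf N hΩ.stable)).resolve_left
      (hV.inf_vacuum_ne_bot hq hk (by simpa [hS] using hN) fun _ _ => hop _)
  have hHeis := hV.isHeisenbergSystem hq hk
  have htop : S = ⊤ := by
    refine hHeis.isOscillatorSystem.eq_top_of_commonKernel_le hV.isTruncFiltration ?_
      fun _ => hop _
    rw [hHeis.commonKernel_dualAnn, ← vacuum_eq_commonKernel hq hk]
    exact inf_eq_right.mp hinf
  simpa [hS] using htop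

end IsRestricted

end Irreducibility

end

end QuantumZ

theorem proposition2p4_general (T : QuantumZ.DynkinType) (h : ℂ)
    (hq : ∀ n : ℕ, 0 < n → Complex.exp h ^ n ≠ 1) (k : ℚ) (hk : k ≠ 0)
    (V : Type*) [AddCommGroup V] [Module ℂ V] [Module (QuantumZ.Uq T h) V]
    [IsScalarTower ℂ (QuantumZ.Uq T h) V] (hV : QuantumZ.IsRestricted T h k V) :
    (∀ (ε : ℤˣ) (i : Fin T.rank) (n : ℤ) (v : V),
        (Function.support (QuantumZ.ZTerm T h k ε i n v)).Finite) ∧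
      QuantumZ.ZStable T h k V (QuantumZ.vacuum T h k V) ∧
      (IsSimpleModule (QuantumZ.Uq T h) V ↔
        QuantumZ.ZIrreducible T h k V (QuantumZ.vacuum T h k V)) :=
  have hinj := QuantumZ.qChar_injective hq
  ⟨hV.zTerm_support_finite, hV.zStable_vacuum hinj hk, fun _ => hV.zIrreducible_vacuum hinj hk,
    hV.isSimpleModule_of_zIrreducible hinj hk⟩

theorem proposition2p4 (T : QuantumZ.DynkinType) (h : ℂ)
    (hq : ∀ n : ℕ, 0 < n → Complex.exp h ^ n ≠ 1) (k : ℚ) (hk : k ≠ 0)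
    (V : Type*) [AddCommGroup V] [Module ℂ V] [Module (QuantumZ.Uq T h) V]
    [IsScalarTower ℂ (QuantumZ.Uq T h) V] (hV : QuantumZ.InCategory T h k V) :
    (∀ (ε : ℤˣ) (i : Fin T.rank) (n : ℤ) (v : V),
        (Function.support (QuantumZ.ZTerm T h k ε i n v)).Finite) ∧
      QuantumZ.ZStable T h k V (QuantumZ.vacuum T h k V) ∧
      (IsSimpleModule (QuantumZ.Uq T h) V ↔
        QuantumZ.ZIrreducible T h k V (QuantumZ.vacuum T h k V)) :=
  proposition2p4_general T h hq k hk V hV.isRestricted
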